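/- Theorem. For a finite sequence $S$ let $|S|$ be its length and $\|S\|$ the number of its distinct symbols. $S=a_1a_2\ldots$ is called $r$-sparse if $a_i\ne a_j$ whenever $1\le |i-j|\le r-1$. It is called $u$-free, for a sequence $u$, if no (not necessarily contiguous) subsequence of $S$ can be obtained from $u$ by a one-to-one renaming of symbols. For a sequence $u$ with $\|u\|=r$, let $\mathrm{Ex}_u(n)$ be the maximum length of an $r$-sparse, $u$-free sequence on $n$ distinct symbols. Let $A_1(n)=2n$, $A_k(n)=A_{k-1}^{(n)}(1)$ for $k\ge 2$ (the $n$-fold iterate of $A_{k-1}$ applied to $1$), and let $\alpha(x)=\min\{k\ge 1 : A_k(3)\ge x\}$ be the inverse Ackermann function. Let $r,s$ be integers with $s\ge r+3$, and let $t=\lfloor (s-r-2)/2\rfloor$. There is a constant $C$, depending only on $r$ and $s$, such that for every sequence $u$ with $\|u\|=r$ and $|u|=s$ and for every integer $n\ge 0$, the maximum defining $\mathrm{Ex}_u(n)$ exists and $$\mathrm{Ex}_u(n)\le n\cdot 2^{(1/t!)\,\alpha(n)^t + C\,\alpha(n)^{t-1}}\quad\text{if } s-r \text{ is even},$$ $$\mathrm{Ex}_u(n)\le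 n\cdot 2^{(1/t!)\,\alpha(n)^t\log_2\alpha(n) + C\,\alpha(n)^{t}}\quad\text{if } s-r \text{ is odd}.$$ -/

import Mathlib

namespace GenDS

/-- The number `‖S‖` of distinct symbols of a finite sequence `S`. -/
noncomputable def numSymbols {β : Type*} (S : List β) : ℕ :=
  {x | x ∈ S}.ncard

/-- `Contains S u`: the sequence `S` has a (not necessarily contiguous) subsequence that is obtained
from `u` by a one-to-one renaming of the symbols of `u`. -/
def Contains {β γ : Type*} (S : List γ) (u : List β) : Prop :=
  ∃ f : β → γ, Set.InjOn f {x | x ∈ u} ∧ (u.map f).Sublist S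

/-- `S` is `r`-sparse: `S i ≠ S j` whenever `1 ≤ j - i ≤ r - 1`. -/
def IsSparse {γ : Type*} (r : ℕ) (S : List γ) : Prop :=
  ∀ (i j : ℕ) (hi : i < S.length) (hj : j < S.length), i < j → j < i + r → S[i] ≠ S[j]

/-- The lengths of the `‖u‖`-sparse, `u`-free sequences on `n` distinct symbols. Since only equality
of symbols matters, the symbols are taken to be natural numbers. -/
def freeLengths {β : Type*} (u : List β) (n : ℕ) : Set ℕ :=
  {L | ∃ S : List ℕ, IsSparse (numSymbols u) S ∧ ¬ Contains S u ∧ numSymbols S = n ∧ S.length = L}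

/-- `Ex_u(n)`, the maximum length of a `‖u‖`-sparse, `u`-free sequence on `n` distinct symbols. -/
noncomputable def Ex {β : Type*} (u : List β) (n : ℕ) : ℕ :=
  sSup (freeLengths u n)

/-- The Ackermann hierarchy: `A_1(n) = 2n` and `A_k(n) = A_{k-1}^{(n)}(1)` for `k ≥ 2`. The hierarchy
starts at `k = 1`; the value at `k = 0` is never used. -/
def ackHierarchy : ℕ → ℕ → ℕ
  | 0, _ => 0
  | 1, n => 2 * n
  | k + 2, n => (ackHierarchy (k + 1))^[n] 1

/-- The Ackermann function `A(k) = A_k(3)`, for `k ≥ 1`. -/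
def ackermann (k : ℕ) : ℕ := ackHierarchy k 3

/-- The inverse Ackermann function `α(x) = min {k ≥ 1 | A(k) ≥ x}`. -/
noncomputable def invAckermann (x : ℝ) : ℕ :=
  sInf {k : ℕ | 1 ≤ k ∧ x ≤ (ackermann k : ℝ)}

end GenDS

namespace GenDS

/-! Call `r` symbols that all occur in each of `σ` consecutive segments an `(r, σ)`-formation. With
`r = ‖u‖` and `σ = |u| - r + 1`, every such formation contains `u`, so it suffices to bound
`r`-sparse sequences without `(r, σ)`-formations.

Cut such a sequence greedily into chunks that only just contain an `(r, σ - 2)`-formation. Every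
full chunk holds the first or last occurrence of some symbol (`FormationFree.card_chunks_le`), so
there are at most `2n + 1` chunks, and induction on `σ` in steps of two bounds the length of a chunk
by its number of distinct symbols. It remains to count pairs (symbol, chunk), which forgets the
order inside chunks.

For this count, `SymbolBound.layers` shows recursively that few symbols occur in more than `T_s(d) =
occThreshold s d` blocks; cutting symbols into groups of `T_s(d) + 1` occurrences then bounds all
occurrences (`SymbolBound.sum_card_le`). The admissible number of blocks grows in `d` like the
Ackermann hierarchy, so `d = α(n)` works.

Finally `T_s(d+1) = T_s(d) T_{s-2}(d+1) + 2 T_{s-1}(d+1)`, so `log T_s(d)` is essentially the sum of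
`log T_{s-2}(i)` over `i ≤ d`. Since `T_4` is linear and `T_5` is of order `2^d`, repeated summation
yields `d^t/t!`, with an extra `log d` for even `s`. -/

open Finset

/-! ### Formations in families of occurrence sets and the layer recurrence. -/

/-- The family `X` of occurrence sets, indexed by the symbols in `V`, has an `(r, s)`-formation:
`r` symbols that all occur in each of `s` consecutive intervals. -/
def Formation {ι : Type} (r s : ℕ) (V : Finset ι) (X : ι → Finset ℕ) : Prop :=
  ∃ R ⊆ V, R.card = r ∧ ∃ c : ℕ → ℕ, Monotone c ∧
    ∀ i < s, ∀ v ∈ R, ∃ x ∈ X v, c i ≤ x ∧ x < c (i + 1)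

/-- A family on `m` blocks without `(r, s)`-formations, whose symbols all occur in at least `k`
blocks, has at most `N` symbols. -/
def SymbolBound (r s k m N : ℕ) : Prop :=
  ∀ (ι : Type) (V : Finset ι) (X : ι → Finset ℕ) (a : ℕ),
    (∀ v ∈ V, X v ⊆ Finset.Ico a (a + m)) → (∀ v ∈ V, k ≤ (X v).card) →
    ¬ Formation r s V X → V.card ≤ N

/-- A formation living before `e` gains an interval when all its symbols occur again after `e`. This
and its mirror image are what lower `s` in the layer recurrence. -/
theorem Formation.extend_right {ι : Type} {r s : ℕ} {V W : Finset ι} {X Y : ι → Finset ℕ}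
    (hWV : W ⊆ V) (hY : ∀ v ∈ W, Y v ⊆ X v) (e e' : ℕ) (hlt : ∀ v ∈ W, ∀ x ∈ Y v, x < e)
    (hge : ∀ v ∈ W, ∃ x ∈ X v, e ≤ x ∧ x < e') (h : Formation r s W Y) :
    Formation r (s + 1) V X := by
  obtain ⟨R, hR, hcard, c, hc, H⟩ := h
  refine ⟨R, hR.trans hWV, hcard, fun i => if i ≤ s then min (c i) e else max e e', ?_, ?_⟩
  · intro i j hij
    have := hc hij
    dsimp only
    split_ifs <;> omega
  · intro i hi v hv
    rcases Nat.lt_succ_iff_lt_or_eq.1 hi with hi | rfl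
    · obtain ⟨x, hx, h1, h2⟩ := H i hi v hv
      have := hlt v (hR hv) x hx
      refine ⟨x, hY v (hR hv) hx, ?_, ?_⟩
      · dsimp only; split_ifs <;> omega
      · dsimp only; split_ifs <;> omega
    · obtain ⟨x, hx, h1, h2⟩ := hge v (hR hv)
      refine ⟨x, hx, ?_, ?_⟩
      · dsimp only; split_ifs <;> omega
      · dsimp only; split_ifs <;> omega

theorem Formation.extend_left {ι : Type} {r s : ℕ} {V W : Finset ι} {X Y : ι → Finset ℕ}
    (hWV : W ⊆ V) (hY : ∀ v ∈ W, Y v ⊆ X v) (e : ℕ) (hge : ∀ v ∈ W, ∀ x ∈ Y v, e ≤ x)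
    (hlt : ∀ v ∈ W, ∃ x ∈ X v, x < e) (h : Formation r s W Y) :
    Formation r (s + 1) V X := by
  obtain ⟨R, hR, hcard, c, hc, H⟩ := h
  refine ⟨R, hR.trans hWV, hcard, fun i => if i = 0 then 0 else max (c (i - 1)) e, ?_, ?_⟩
  · intro i j hij
    have := hc (Nat.sub_le_sub_right hij 1)
    dsimp only
    split_ifs <;> omega
  · rintro (_ | i) hi v hv
    · obtain ⟨x, hx, h1⟩ := hlt v (hR hv)
      refine ⟨x, hx, by simp, by simp [h1]⟩
    · obtain ⟨x, hx, h1, h2⟩ := H i (by omega) v hv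
      have := hge v (hR hv) x hx
      refine ⟨x, hY v (hR hv) hx, ?_, ?_⟩
      · simpa using ⟨h1, this⟩
      · simpa using Or.inl h2

/-- Pigeonhole on the first occurrence: `r` symbols first occurring in the same block `y` all occur
in `y` and again after it. -/
theorem symbolBound_two (r m : ℕ) : SymbolBound r 2 2 m (r * m) := by
  classical
  intro ι V X a hX hk hF
  by_contra! hlt
  have hne : ∀ v ∈ V, (X v).Nonempty := fun v hv => card_pos.1 (by have := hk v hv; omega)
  choose! f hf using fun v hv => Finset.exists_minimal (hne v hv)
  have hmaps : ∀ v ∈ V, f v ∈ Ico a (a + m) := fun v hv => hX v hv (hf v hv).1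
  obtain ⟨y, -, hy⟩ := exists_lt_card_fiber_of_mul_lt_card_of_maps_to hmaps
    (n := r) (by rw [Nat.card_Ico]; simpa [mul_comm] using hlt)
  obtain ⟨R, hR, hcard⟩ := exists_subset_card_eq hy.le
  refine hF ⟨R, hR.trans (filter_subset _ _), hcard,
    fun i => if i = 0 then y else if i = 1 then y + 1 else y + 1 + a + m, ?_, ?_⟩
  · intro i j hij
    dsimp only
    split_ifs <;> omega
  · intro i hi v hv
    obtain ⟨hvV, hvy⟩ := mem_filter.1 (hR hv)
    interval_cases i
    · exact ⟨f v, (hf v hvV).1, by simp [hvy], by simp [hvy]⟩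
    · obtain ⟨x, hx, hne⟩ := exists_mem_ne (s := X v) (hk v hvV) (f v)
      have h1 := (hf v hvV).2 hx
      have h2 := mem_Ico.1 (hX v hvV hx)
      have h3 : f v ≤ x := by
        rcases le_total (f v) x with h | h
        · exact h
        · exact h1 h
      refine ⟨x, hx, ?_, ?_⟩
      · simp; omega
      · simp; omega

/-- Pigeonhole on an occurrence that is neither first nor last: the three intervals are before `y`,
the block `y`, and after `y`. -/
theorem symbolBound_three (r m : ℕ) : SymbolBound r 3 3 m (r * m) := by
  classical
  intro ι V X a hX hk hF
  by_contra! hlt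
  have hmid : ∀ v ∈ V, ∃ y ∈ X v, (∃ x ∈ X v, x < y) ∧ ∃ z ∈ X v, y < z := by
    intro v hv
    have h3 := hk v hv
    have hne : (X v).Nonempty := card_pos.1 (by omega)
    obtain ⟨y, hy⟩ : (((X v).erase ((X v).min' hne)).erase ((X v).max' hne)).Nonempty := by
      apply card_pos.1
      have h4 := pred_card_le_card_erase (s := X v) (a := (X v).min' hne)
      have h5 := pred_card_le_card_erase (s := (X v).erase ((X v).min' hne))
        (a := (X v).max' hne)
      omega
    simp only [mem_erase] at hy
    obtain ⟨h1, h2, h3⟩ := hy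
    exact ⟨y, h3, ⟨_, min'_mem _ hne, lt_of_le_of_ne (min'_le _ _ h3) (Ne.symm h2)⟩,
      ⟨_, max'_mem _ hne, lt_of_le_of_ne (le_max' _ _ h3) h1⟩⟩
  choose! f hf using hmid
  have hmaps : ∀ v ∈ V, f v ∈ Ico a (a + m) := fun v hv => hX v hv (hf v hv).1
  obtain ⟨y, -, hy⟩ := exists_lt_card_fiber_of_mul_lt_card_of_maps_to hmaps
    (n := r) (by rw [Nat.card_Ico]; simpa [mul_comm] using hlt)
  obtain ⟨R, hR, hcard⟩ := exists_subset_card_eq hy.le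
  refine hF ⟨R, hR.trans (filter_subset _ _), hcard,
    fun i => if i = 0 then 0 else if i = 1 then y else if i = 2 then y + 1 else y + 1 + a + m,
    ?_, ?_⟩
  · intro i j hij
    dsimp only
    split_ifs <;> omega
  · intro i hi v hv
    obtain ⟨hvV, hvy⟩ := mem_filter.1 (hR hv)
    obtain ⟨h1, ⟨x, hx, hxy⟩, ⟨z, hz, hyz⟩⟩ := hf v hvV
    interval_cases i
    · exact ⟨x, hx, by simp, by simp; omega⟩
    · exact ⟨f v, h1, by simp [hvy], by simp [hvy]⟩
    · have h2 := mem_Ico.1 (hX v hvV hz)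
      exact ⟨z, hz, by simp; omega, by simp; omega⟩

/-- Cutting `t * q` blocks into `q` layers of `t` blocks. -/
theorem SymbolBound.layers {r s t q k k₁ k₂ k₃ N N₁ N₂ N₃ : ℕ} (ht : 0 < t)
    (h : SymbolBound r (s + 2) (k + 1) t N) (h₁ : SymbolBound r (s + 1) (k₁ + 1) t N₁)
    (h₂ : SymbolBound r s (k₂ + 1) t N₂) (h₃ : SymbolBound r (s + 2) (k₃ + 1) q N₃)
    (hk : 2 * k₁ + k₃ * k₂ ≤ k) :
    SymbolBound r (s + 2) (k + 1) (t * q) (q * (N + 2 * N₁ + N₂) + N₃) := by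
  classical
  intro ι V X a hX hcard hF
  set ℓ : ℕ → ℕ := fun x => (x - a) / t with hℓ
  have hlow : ∀ v ∈ V, ∀ x ∈ X v, a ≤ x := fun v hv x hx => (mem_Ico.1 (hX v hv hx)).1
  have hhigh : ∀ v ∈ V, ∀ x ∈ X v, x < a + t * q := fun v hv x hx => (mem_Ico.1 (hX v hv hx)).2
  have hle : ∀ v ∈ V, ∀ x ∈ X v, ∀ j, j ≤ ℓ x ↔ a + j * t ≤ x := by
    intro v hv x hx j
    rw [hℓ]; dsimp only
    rw [Nat.le_div_iff_mul_le ht]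
    have := hlow v hv x hx
    omega
  have hltq : ∀ v ∈ V, ∀ x ∈ X v, ℓ x < q := by
    intro v hv x hx
    rw [hℓ]; dsimp only
    rw [Nat.div_lt_iff_lt_mul ht, mul_comm]
    have := hlow v hv x hx
    have := hhigh v hv x hx
    omega
  set piece : ι → ℕ → Finset ℕ := fun v j => (X v).filter (fun x => ℓ x = j) with hpiece
  have hpsub : ∀ v j, piece v j ⊆ X v := fun v j => filter_subset _ _
  have hpge : ∀ v ∈ V, ∀ j, ∀ x ∈ piece v j, a + j * t ≤ x := by
    intro v hv j x hx
    obtain ⟨hx, hj⟩ := mem_filter.1 hx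
    exact (hle v hv x hx j).1 hj.ge
  have hplt : ∀ v ∈ V, ∀ j, ∀ x ∈ piece v j, x < a + (j + 1) * t := by
    intro v hv j x hx
    obtain ⟨hx, hj⟩ := mem_filter.1 hx
    have := (hle v hv x hx (j + 1)).not.1 (by omega)
    omega
  have hpIco : ∀ v ∈ V, ∀ j, piece v j ⊆ Ico (a + j * t) (a + j * t + t) := by
    intro v hv j x hx
    have h1 := hpge v hv j x hx
    have h2 := hplt v hv j x hx
    rw [add_mul] at h2
    exact mem_Ico.2 ⟨h1, by omega⟩
  -- Five overlapping classes: symbols confined to layer `j`; symbols heavy in layer `j` that also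
  -- occur later, earlier, or both (losing one, one or two intervals); and symbols that meet many
  -- layers.
  let local_ : ℕ → Finset ι := fun j => V.filter (fun v => ∀ x ∈ X v, ℓ x = j)
  let first : ℕ → Finset ι := fun j => V.filter (fun v => k₁ < (piece v j).card ∧ ∃ x ∈ X v, j < ℓ x)
  let last : ℕ → Finset ι := fun j => V.filter (fun v => k₁ < (piece v j).card ∧ ∃ x ∈ X v, ℓ x < j)
  let mid : ℕ → Finset ι := fun j => V.filter (fun v => k₂ < (piece v j).card ∧
    (∃ x ∈ X v, ℓ x < j) ∧ ∃ x ∈ X v, j < ℓ x)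
  let wide : Finset ι := V.filter (fun v => k₃ < ((X v).image ℓ).card)
  have hafter : ∀ v ∈ V, ∀ j, (∃ x ∈ X v, j < ℓ x) →
      ∃ x ∈ X v, a + (j + 1) * t ≤ x ∧ x < a + t * q := by
    rintro v hv j ⟨x, hx, hj⟩
    exact ⟨x, hx, (hle v hv x hx (j + 1)).1 hj, hhigh v hv x hx⟩
  have hbefore : ∀ v ∈ V, ∀ j, (∃ x ∈ X v, ℓ x < j) → ∃ x ∈ X v, x < a + j * t := by
    rintro v hv j ⟨x, hx, hj⟩
    exact ⟨x, hx, not_le.1 ((hle v hv x hx j).not.1 (by omega))⟩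
  have hlocal : ∀ j, (local_ j).card ≤ N := by
    intro j
    have hsub : local_ j ⊆ V := filter_subset _ _
    refine h ι (local_ j) X (a + j * t) (fun v hv x hx => ?_) (fun v hv => hcard v (hsub hv)) ?_
    · exact hpIco v (hsub hv) j (mem_filter.2 ⟨hx, (mem_filter.1 hv).2 x hx⟩)
    · rintro ⟨R, hR, H⟩
      exact hF ⟨R, hR.trans hsub, H⟩
  have hfirst : ∀ j, (first j).card ≤ N₁ := by
    intro j
    have hsub : first j ⊆ V := filter_subset _ _
    refine h₁ ι (first j) (fun v => piece v j) (a + j * t) (fun v hv => hpIco v (hsub hv) j)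
      (fun v hv => (mem_filter.1 hv).2.1) fun hform => hF ?_
    exact hform.extend_right hsub (fun v _ => hpsub v j) (a + (j + 1) * t) (a + t * q)
      (fun v hv => hplt v (hsub hv) j) (fun v hv => hafter v (hsub hv) j (mem_filter.1 hv).2.2)
  have hlast : ∀ j, (last j).card ≤ N₁ := by
    intro j
    have hsub : last j ⊆ V := filter_subset _ _
    refine h₁ ι (last j) (fun v => piece v j) (a + j * t) (fun v hv => hpIco v (hsub hv) j)
      (fun v hv => (mem_filter.1 hv).2.1) fun hform => hF ?_
    exact hform.extend_left hsub (fun v _ => hpsub v j) (a + j * t)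
      (fun v hv => hpge v (hsub hv) j) (fun v hv => hbefore v (hsub hv) j (mem_filter.1 hv).2.2)
  have hmid : ∀ j, (mid j).card ≤ N₂ := by
    intro j
    have hsub : mid j ⊆ V := filter_subset _ _
    refine h₂ ι (mid j) (fun v => piece v j) (a + j * t) (fun v hv => hpIco v (hsub hv) j)
      (fun v hv => (mem_filter.1 hv).2.1) fun hform => hF ?_
    -- Extended on both sides: the intermediate family keeps everything before the end of layer `j`,
    -- so the left extension can be made first.
    refine Formation.extend_right (W := mid j)
      (Y := fun v => (X v).filter (fun x => x < a + (j + 1) * t)) hsub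
      (fun v _ => filter_subset _ _) (a + (j + 1) * t) (a + t * q)
      (fun v _ x hx => (mem_filter.1 hx).2)
      (fun v hv => hafter v (hsub hv) j (mem_filter.1 hv).2.2.2) ?_
    refine hform.extend_left subset_rfl
      (fun v hv x hx => mem_filter.2 ⟨hpsub v j hx, hplt v (hsub hv) j x hx⟩) (a + j * t)
      (fun v hv => hpge v (hsub hv) j) (fun v hv => ?_)
    obtain ⟨x, hx, hxj⟩ := hbefore v (hsub hv) j (mem_filter.1 hv).2.2.1
    refine ⟨x, mem_filter.2 ⟨hx, ?_⟩, hxj⟩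
    rw [add_mul]; omega
  have hwide : wide.card ≤ N₃ := by
    have hsub : wide ⊆ V := filter_subset _ _
    -- Each layer is contracted to one block; a formation among layers pulls back under `c ↦ a + c *
    -- t`.
    refine h₃ ι wide (fun v => (X v).image ℓ) 0 (fun v hv y hy => ?_)
      (fun v hv => (mem_filter.1 hv).2) ?_
    · obtain ⟨x, hx, rfl⟩ := mem_image.1 hy
      exact mem_Ico.2 ⟨Nat.zero_le _, by simpa using hltq v (hsub hv) x hx⟩
    · rintro ⟨R, hR, hRc, c, hc, H⟩
      refine hF ⟨R, hR.trans hsub, hRc, fun i => a + c i * t, fun i j hij => ?_, ?_⟩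
      · exact Nat.add_le_add_left (Nat.mul_le_mul_right t (hc hij)) a
      · intro i hi v hv
        obtain ⟨y, hy, h1, h2⟩ := H i hi v hv
        obtain ⟨x, hx, rfl⟩ := mem_image.1 hy
        have hvV := hsub (hR hv)
        exact ⟨x, hx, (hle v hvV x hx _).1 h1,
          not_le.1 ((hle v hvV x hx _).not.1 (by omega))⟩
  have hcover : V ⊆ (range q).biUnion
      (fun j => (local_ j ∪ (first j ∪ last j)) ∪ mid j) ∪ wide := by
    intro v hv
    by_contra hnot
    simp only [mem_union, mem_biUnion, mem_range, not_or, not_exists, not_and] at hnot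
    obtain ⟨hnj, hnw⟩ := hnot
    have hne : (X v).Nonempty := card_pos.1 (by have := hcard v hv; omega)
    obtain ⟨x₀, hx₀, hmin⟩ := exists_min_image (X v) ℓ hne
    obtain ⟨x₁, hx₁, hmax⟩ := exists_max_image (X v) ℓ hne
    have hw : ((X v).image ℓ).card ≤ k₃ := not_lt.1 fun hlt => hnw (mem_filter.2 ⟨hv, hlt⟩)
    have hlt01 : ℓ x₀ < ℓ x₁ := by
      by_contra hcon
      refine (hnj (ℓ x₀) (hltq v hv x₀ hx₀)).1.1 (mem_filter.2 ⟨hv, fun x hx => ?_⟩)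
      have := hmin x hx
      have := hmax x hx
      omega
    have hp0 : (piece v (ℓ x₀)).card ≤ k₁ := not_lt.1 fun hlt =>
      (hnj _ (hltq v hv x₀ hx₀)).1.2.1 (mem_filter.2 ⟨hv, hlt, x₁, hx₁, hlt01⟩)
    have hp1 : (piece v (ℓ x₁)).card ≤ k₁ := not_lt.1 fun hlt =>
      (hnj _ (hltq v hv x₁ hx₁)).1.2.2 (mem_filter.2 ⟨hv, hlt, x₀, hx₀, hlt01⟩)
    -- An uncovered symbol has at most `k₁` occurrences in its first and last layers and at most
    -- `k₂` in the others. Over at most `k₃` layers this gives `2 * k₁ + k₃ * k₂ ≤ k`, too few.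
    have hpj : ∀ j ∈ (X v).image ℓ, (piece v j).card ≤
        ((if j = ℓ x₀ then k₁ else 0) + (if j = ℓ x₁ then k₁ else 0)) + k₂ := by
      intro j hj
      obtain ⟨x, hx, rfl⟩ := mem_image.1 hj
      by_cases e0 : ℓ x = ℓ x₀
      · rw [if_pos e0, e0]; omega
      by_cases e1 : ℓ x = ℓ x₁
      · rw [if_pos e1, e1]; omega
      have hm : (piece v (ℓ x)).card ≤ k₂ := not_lt.1 fun hlt =>
        (hnj _ (hltq v hv x hx)).2 (mem_filter.2 ⟨hv, hlt,
          ⟨x₀, hx₀, lt_of_le_of_ne (hmin x hx) (Ne.symm e0)⟩,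
          ⟨x₁, hx₁, lt_of_le_of_ne (hmax x hx) e1⟩⟩)
      omega
    have hsum : (X v).card = ∑ j ∈ (X v).image ℓ, (piece v j).card :=
      card_eq_sum_card_image ℓ (X v)
    have hsum2 := sum_le_sum hpj
    rw [← hsum, sum_add_distrib, sum_add_distrib, sum_ite_eq', sum_ite_eq',
      if_pos (mem_image_of_mem ℓ hx₀), if_pos (mem_image_of_mem ℓ hx₁), sum_const,
      smul_eq_mul] at hsum2
    have := Nat.mul_le_mul_right k₂ hw
    have := hcard v hv
    omega
  calc V.card ≤ _ := card_le_card hcover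
    _ ≤ _ := card_union_le _ _
    _ ≤ q * (N + 2 * N₁ + N₂) + N₃ := by
      refine Nat.add_le_add ?_ hwide
      refine (card_biUnion_le_card_mul _ _ (N + 2 * N₁ + N₂) fun j _ => ?_).trans
        (by rw [card_range])
      have e1 := card_union_le (local_ j ∪ (first j ∪ last j)) (mid j)
      have e2 := card_union_le (local_ j) (first j ∪ last j)
      have e3 := card_union_le (first j) (last j)
      have := hlocal j
      have := hfirst j
      have := hlast j
      have := hmid j
      omega

/-! ### Solving the recurrence along an Ackermann-type hierarchy. -/

/-- Symbols occurring more than `occThreshold s d` times are few at the `d`-th level of the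
Ackermann hierarchy. -/
def occThreshold : ℕ → ℕ → ℕ
  | 0, _ => 1
  | 1, _ => 1
  | 2, _ => 1
  | 3, _ => 2
  -- With `5 ^ 1` blocks no symbol can occur in `5 + 1` of them, so the base level is vacuous.
  | _ + 4, 0 => 5
  | s + 4, d + 1 =>
    occThreshold (s + 4) d * occThreshold (s + 2) (d + 1) + 2 * occThreshold (s + 3) (d + 1)
termination_by s d => (s, d)

/-- The numbers of blocks at level `d` are the powers `5 ^ blockExp d x`. -/
def blockExp : ℕ → ℕ → ℕ
  | 0, _ => 1
  | _ + 1, 0 => 1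
  | d + 1, x + 1 => blockExp (d + 1) x + blockExp d (blockExp (d + 1) x)
termination_by d x => (d, x)

theorem occThreshold_succ (s d : ℕ) : occThreshold (s + 4) (d + 1) =
    occThreshold (s + 4) d * occThreshold (s + 2) (d + 1) + 2 * occThreshold (s + 3) (d + 1) := by
  rw [occThreshold]

theorem occThreshold_pos (s d : ℕ) : 0 < occThreshold s d := by
  fun_induction occThreshold s d <;> omega

theorem five_le_occThreshold (s d : ℕ) : 5 ≤ occThreshold (s + 4) d := by
  induction d with
  | zero => rw [occThreshold]
  | succ d ih =>
    rw [occThreshold]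
    have := Nat.mul_le_mul ih (occThreshold_pos (s + 2) (d + 1))
    omega

theorem symbolBound_of_lt {r s k m : ℕ} (h : m < k) (N : ℕ) : SymbolBound r s k m N := by
  intro ι V X a hX hk _
  rcases V.eq_empty_or_nonempty with rfl | ⟨v, hv⟩
  · simp
  · have h1 := card_le_card (hX v hv)
    rw [Nat.card_Ico] at h1
    have := hk v hv
    omega

theorem SymbolBound.mono_right {r s k m N N' : ℕ} (h : SymbolBound r s k m N) (hN : N ≤ N') :
    SymbolBound r s k m N' :=
  fun ι V X a hX hk hF => (h ι V X a hX hk hF).trans hN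

theorem symbolBound_blockExp (r s d x : ℕ) (hs : 2 ≤ s) :
    SymbolBound r s (occThreshold s d + 1) (5 ^ blockExp d x)
      (r * 5 ^ x * 5 ^ blockExp d x) := by
  induction s using Nat.strong_induction_on generalizing d x with
  | _ s ihs =>
  have hone : r * 5 ^ blockExp d x ≤ r * 5 ^ x * 5 ^ blockExp d x :=
    Nat.mul_le_mul_right _ (Nat.le_mul_of_pos_right _ (by positivity))
  match s, hs with
  | 2, _ => rw [occThreshold]; exact (symbolBound_two r _).mono_right hone
  | 3, _ => rw [occThreshold]; exact (symbolBound_three r _).mono_right hone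
  | s + 4, _ =>
  clear hone
  induction d generalizing x with
  | zero =>
    apply symbolBound_of_lt
    rw [blockExp]
    have := five_le_occThreshold s 0
    omega
  | succ d ihd =>
    induction x with
    | zero =>
      apply symbolBound_of_lt
      rw [blockExp]
      have := five_le_occThreshold s (d + 1)
      omega
    | succ x ihx =>
      -- Level `d` is used at `blockExp (d + 1) x`, so that its coefficient `5 ^ blockExp (d + 1) x`
      -- equals the layer size `t`, and wide symbols cost only `r * t * q`.
      have h3 := ihd (blockExp (d + 1) x)
      have h1 := ihs (s + 3) (by omega) (d + 1) x (by omega)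
      have h2 := ihs (s + 2) (by omega) (d + 1) x (by omega)
      have key := SymbolBound.layers (by positivity) ihx h1 h2 h3
        (by rw [occThreshold_succ]; omega)
      -- The classes inside layers contribute `4 * 5 ^ x` and the wide symbols `1`, in units of `r *
      -- t * q`; the base `5` absorbs both in `5 ^ (x + 1)`.
      rw [blockExp, pow_add]
      refine key.mono_right (le_of_eq_of_le
        (b := 5 ^ blockExp d (blockExp (d + 1) x) * 5 ^ blockExp (d + 1) x * r * (4 * 5 ^ x + 1))
        (by ring) ?_)
      have : 1 ≤ 5 ^ x := Nat.one_le_pow _ _ (by norm_num)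
      calc _ ≤ 5 ^ blockExp d (blockExp (d + 1) x) * 5 ^ blockExp (d + 1) x * r *
            (5 * 5 ^ x) := Nat.mul_le_mul_left _ (by omega)
        _ = _ := by ring

/-! ### From the number of heavy symbols to the total number of occurrences. -/

theorem nth_mem_finset (X : Finset ℕ) {l : ℕ} (hl : l < X.card) : Nat.nth (· ∈ X) l ∈ X := by
  have hf : {x | x ∈ X}.Finite := X.finite_toSet
  refine Nat.nth_mem_of_lt_card hf ?_
  have : hf.toFinset = X := by ext; simp
  rwa [this]

theorem nth_lt_nth_finset (X : Finset ℕ) {l l' : ℕ} (h : l < l') (hl : l' < X.card) :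
    Nat.nth (· ∈ X) l < Nat.nth (· ∈ X) l' := by
  have hf : {x | x ∈ X}.Finite := X.finite_toSet
  refine Nat.nth_lt_nth_of_lt_card hf h ?_
  have : hf.toFinset = X := by ext; simp
  rwa [this]

/-- Each symbol is cut into groups of `k` consecutive occurrences, and `K` shifted copies of the
resulting family are put side by side. -/
theorem SymbolBound.sum_card_le {r s k m N : ℕ} (hr : 0 < r) (hs : 2 ≤ s) (hk : 0 < k)
    (h : SymbolBound r s k m N) {ι : Type} (V : Finset ι) (X : ι → Finset ℕ) (K M : ℕ)
    (hM : K * M ≤ m) (hX : ∀ v ∈ V, ∀ x ∈ X v, x < M) (hF : ¬ Formation r s V X) :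
    K * ∑ v ∈ V, (X v).card ≤ k * (N + K * V.card) := by
  classical
  -- A new symbol is (old symbol, (copy, group)).
  let W : Finset (Σ _ : ι, ℕ × ℕ) := V.sigma fun v => range K ×ˢ range ((X v).card / k)
  let Y : (Σ _ : ι, ℕ × ℕ) → Finset ℕ := fun p =>
    (range k).image fun l => p.2.1 * M + Nat.nth (· ∈ X p.1) (p.2.2 * k + l)
  have hW : ∀ p ∈ W, p.1 ∈ V ∧ p.2.1 < K ∧ ∀ l < k, p.2.2 * k + l < (X p.1).card := by
    intro p hp
    simp only [W, mem_sigma, mem_product, mem_range] at hp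
    obtain ⟨h1, h2, h3⟩ := hp
    refine ⟨h1, h2, fun l hl => ?_⟩
    have := (Nat.le_div_iff_mul_le hk).1 (Nat.succ_le_of_lt h3)
    rw [Nat.succ_mul] at this
    omega
  have hYmem : ∀ p ∈ W, ∀ y ∈ Y p, ∃ x ∈ X p.1, y = p.2.1 * M + x ∧ x < M := by
    intro p hp y hy
    obtain ⟨h1, h2, h3⟩ := hW p hp
    obtain ⟨l, hl, rfl⟩ := mem_image.1 hy
    have := nth_mem_finset _ (h3 l (mem_range.1 hl))
    exact ⟨_, this, rfl, hX _ h1 _ this⟩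
  have hcard : ∀ p ∈ W, k ≤ (Y p).card := by
    intro p hp
    obtain ⟨h1, h2, h3⟩ := hW p hp
    rw [card_image_of_injOn, card_range]
    intro l hl l' hl' he
    simp only [coe_range, Set.mem_Iio] at hl hl'
    dsimp only at he
    by_contra hne
    rcases lt_or_gt_of_ne hne with hlt | hlt
    · have := nth_lt_nth_finset (X p.1) (Nat.add_lt_add_left hlt (p.2.2 * k)) (h3 _ hl')
      omega
    · have := nth_lt_nth_finset (X p.1) (Nat.add_lt_add_left hlt (p.2.2 * k)) (h3 _ hl)
      omega
  have hIco : ∀ p ∈ W, Y p ⊆ Ico 0 (0 + m) := by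
    intro p hp y hy
    obtain ⟨x, hx, rfl, hxM⟩ := hYmem p hp y hy
    have h2 := Nat.mul_le_mul_right M (Nat.succ_le_of_lt (hW p hp).2.1)
    rw [Nat.succ_mul] at h2
    exact mem_Ico.2 ⟨Nat.zero_le _, by omega⟩
  have hfree : ¬ Formation r s W Y := by
    rintro ⟨R, hR, hRcard, c, hc, H⟩
    -- Two members of a formation with at least two intervals interleave. Hence a formation stays in
    -- one copy and uses at most one group per old symbol, so it projects to a formation of `X`.
    have hsep : ∀ p ∈ R, ∀ p' ∈ R, ¬ ∀ y ∈ Y p, ∀ y' ∈ Y p', y < y' := by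
      intro p hp p' hp' hlt
      obtain ⟨y, hy, h1, -⟩ := H 1 (by omega) p hp
      obtain ⟨y', hy', -, h2⟩ := H 0 (by omega) p' hp'
      have := hlt y hy y' hy'
      simp only [zero_add] at h2
      omega
    have hcopy : ∀ p ∈ R, ∀ p' ∈ R, ¬ p.2.1 < p'.2.1 := by
      intro p hp p' hp' hlt
      refine hsep p hp p' hp' fun y hy y' hy' => ?_
      obtain ⟨x, hx, rfl, hxM⟩ := hYmem p (hR hp) y hy
      obtain ⟨x', hx', rfl, hxM'⟩ := hYmem p' (hR hp') y' hy'
      have := Nat.mul_le_mul_right M (Nat.succ_le_of_lt hlt)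
      rw [Nat.succ_mul] at this
      omega
    have hcopy' : ∀ p ∈ R, ∀ p' ∈ R, p.2.1 = p'.2.1 := fun p hp p' hp' =>
      le_antisymm (not_lt.1 (hcopy p' hp' p hp)) (not_lt.1 (hcopy p hp p' hp'))
    have hgroup : ∀ p ∈ R, ∀ p' ∈ R, p.1 = p'.1 → ¬ p.2.2 < p'.2.2 := by
      rintro ⟨v, j, i⟩ hp ⟨v', j', i'⟩ hp' hv hlt
      dsimp only at hv hlt
      subst hv
      refine hsep _ hp _ hp' fun y hy y' hy' => ?_
      obtain ⟨l, hl, rfl⟩ := mem_image.1 hy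
      obtain ⟨l', hl', rfl⟩ := mem_image.1 hy'
      have e := hcopy' _ hp _ hp'
      dsimp only at e ⊢
      rw [e]
      have hi := Nat.mul_le_mul_right k (Nat.succ_le_of_lt hlt)
      rw [Nat.succ_mul] at hi
      have := mem_range.1 hl
      have := mem_range.1 hl'
      have := nth_lt_nth_finset (X v) (show i * k + l < i' * k + l' by omega)
        ((hW _ (hR hp')).2.2 l' (by omega))
      omega
    have hinj : Set.InjOn (fun p : Σ _ : ι, ℕ × ℕ => p.1) R := by
      rintro ⟨v, j, i⟩ hp ⟨v', j', i'⟩ hp' hv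
      have e1 := hcopy' _ hp _ hp'
      have e2 := not_lt.1 (hgroup _ hp _ hp' hv)
      have e3 := not_lt.1 (hgroup _ hp' _ hp hv.symm)
      have e4 := le_antisymm e3 e2
      dsimp only at hv e1 e4
      subst hv e1 e4
      rfl
    obtain ⟨p₀, hp₀⟩ : R.Nonempty := card_pos.1 (by omega)
    refine hF ⟨R.image fun p => p.1, ?_, by rw [card_image_of_injOn hinj, hRcard],
      fun i => c i - p₀.2.1 * M, fun i j hij => Nat.sub_le_sub_right (hc hij) _, ?_⟩
    · intro v hv
      obtain ⟨p, hp, rfl⟩ := mem_image.1 hv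
      exact (hW p (hR hp)).1
    · intro i hi v hv
      obtain ⟨p, hp, rfl⟩ := mem_image.1 hv
      obtain ⟨y, hy, h1, h2⟩ := H i hi p hp
      obtain ⟨x, hx, rfl, hxM⟩ := hYmem p (hR hp) y hy
      rw [hcopy' p hp p₀ hp₀] at h1 h2
      exact ⟨x, hx, by dsimp only; omega, by dsimp only; omega⟩
  have hN := h _ W Y 0 hIco hcard hfree
  have hWcard : W.card = ∑ v ∈ V, K * ((X v).card / k) := by
    simp [W, card_sigma]
  calc K * ∑ v ∈ V, (X v).card ≤ K * ∑ v ∈ V, (k * ((X v).card / k) + k) := by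
        refine Nat.mul_le_mul_left _ (sum_le_sum fun v _ => ?_)
        have := Nat.div_add_mod (X v).card k
        have := Nat.mod_lt (X v).card hk
        omega
    _ = k * (∑ v ∈ V, K * ((X v).card / k) + K * V.card) := by
        rw [sum_add_distrib, sum_const, smul_eq_mul, ← mul_sum, ← mul_sum]
        ring
    _ ≤ k * (N + K * V.card) := by rw [← hWcard]; gcongr

/-- The symbol bound is available only at `B = 5 ^ blockExp d 3` blocks, but it is linear in `B`;
packing `B / M` copies of the `M` blocks transfers it to `M`. The constant is `250 = 2 * 5 ^ 3`, the
`2` coming from rounding in `B / M`. -/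
theorem sum_card_le_of_not_formation {r s d M : ℕ} (hr : 0 < r) (hs : 2 ≤ s) (hM0 : 0 < M)
    (hM : M ≤ 5 ^ blockExp d 3) {ι : Type} (V : Finset ι) (X : ι → Finset ℕ)
    (hX : ∀ v ∈ V, ∀ x ∈ X v, x < M) (hF : ¬ Formation r s V X) :
    ∑ v ∈ V, (X v).card ≤ (occThreshold s d + 1) * (250 * r * M + V.card) := by
  set B := 5 ^ blockExp d 3 with hB
  have hK : 0 < B / M := Nat.div_pos hM hM0
  have key := (symbolBound_blockExp r s d 3 hs).sum_card_le hr hs (Nat.succ_pos _) V X (B / M) M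
    (Nat.div_mul_le_self B M) hX hF
  have hBle : B ≤ 2 * (B / M * M) := by
    have h1 := Nat.div_add_mod B M
    have h2 := Nat.mod_lt B hM0
    have h3 := Nat.le_mul_of_pos_left M hK
    rw [mul_comm] at h1
    omega
  refine Nat.le_of_mul_le_mul_left (key.trans ?_) hK
  calc (occThreshold s d).succ * (r * 5 ^ 3 * B + B / M * V.card)
      ≤ (occThreshold s d).succ * (r * 5 ^ 3 * (2 * (B / M * M)) + B / M * V.card) := by gcongr
    _ = _ := by rw [Nat.succ_eq_add_one]; ring

/-! ### Comparison with the Ackermann hierarchy. -/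

theorem blockExp_le_succ (d x : ℕ) : blockExp d x ≤ blockExp d (x + 1) := by
  cases d with
  | zero => simp [blockExp]
  | succ d => rw [blockExp]; omega

theorem blockExp_monotone (d : ℕ) : Monotone (blockExp d) :=
  monotone_nat_of_le_succ (blockExp_le_succ d)

theorem ackHierarchy_succ (k x : ℕ) :
    ackHierarchy (k + 2) (x + 1) = ackHierarchy (k + 1) (ackHierarchy (k + 2) x) := by
  simp only [ackHierarchy, Function.iterate_succ_apply']

theorem blockExp_one (x : ℕ) : blockExp 1 x = x + 1 := by
  induction x with
  | zero => simp [blockExp]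
  | succ x ih => rw [blockExp, ih, blockExp]

theorem ackHierarchy_le_blockExp (k x : ℕ) : ackHierarchy (k + 2) x ≤ blockExp (k + 2) x := by
  induction k generalizing x with
  | zero =>
    induction x with
    | zero => simp [ackHierarchy, blockExp]
    | succ x ih =>
      rw [ackHierarchy_succ, blockExp, blockExp_one]
      change 2 * _ ≤ blockExp 2 x + (blockExp 2 x + 1)
      simp only [zero_add] at ih ⊢
      omega
  | succ k ihk =>
    induction x with
    | zero => simp [ackHierarchy, blockExp]
    | succ x ih =>
      rw [ackHierarchy_succ, blockExp]
      exact ((ihk _).trans (blockExp_monotone _ ih)).trans (Nat.le_add_left _ _)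

/-- Ensures that level `d` accommodates the at most `2 * n + 1` chunks of a sequence on `n ≤
ackermann d` symbols. -/
theorem two_mul_ackermann_le (d : ℕ) (hd : 1 ≤ d) : 2 * ackermann d + 1 ≤ 5 ^ blockExp d 3 := by
  match d, hd with
  | 1, _ => simp [ackermann, ackHierarchy, blockExp_one]
  | k + 2, _ =>
    have h1 : ackermann (k + 2) ≤ blockExp (k + 2) 3 := ackHierarchy_le_blockExp k 3
    have h2 : ∀ b : ℕ, 2 * b + 1 ≤ 5 ^ b := by
      intro b
      induction b with
      | zero => simp
      | succ b ih => rw [pow_succ]; omega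
    have := h2 (blockExp (k + 2) 3)
    omega

theorem lt_ackHierarchy (k x : ℕ) (hx : 1 ≤ x) : x < ackHierarchy (k + 1) x := by
  induction k generalizing x with
  | zero => simp only [ackHierarchy]; omega
  | succ k ih =>
    have h0 : ∀ y, y < ackHierarchy (k + 2) y := by
      intro y
      induction y with
      | zero => simp [ackHierarchy]
      | succ y ihy =>
        rw [ackHierarchy_succ]
        have := ih (ackHierarchy (k + 2) y) (by omega)
        omega
    exact h0 x

/-! ### Formations in sequences, and why they contain `u`. -/

/-- `S` splits into `k` consecutive segments (and a remainder), each containing all of `R`. -/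
def HasRounds {γ : Type*} (R : Finset γ) : ℕ → List γ → Prop
  | 0, _ => True
  | k + 1, S => ∃ S' w, S = S' ++ w ∧ HasRounds R k S' ∧ ∀ z ∈ R, z ∈ w

theorem HasRounds.append {γ : Type*} {R : Finset γ} {a b : ℕ} {S T : List γ}
    (hS : HasRounds R a S) (hT : HasRounds R b T) : HasRounds R (a + b) (S ++ T) := by
  induction b generalizing T with
  | zero =>
    cases a with
    | zero => trivial
    | succ a =>
      obtain ⟨S', w, rfl, h1, h2⟩ := hS
      exact ⟨S', w ++ T, by simp, h1, fun z hz => List.mem_append_left _ (h2 z hz)⟩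
  | succ b ih =>
    obtain ⟨T', w, rfl, h1, h2⟩ := hT
    exact ⟨S ++ T', w, by simp, ih h1, h2⟩

theorem HasRounds.append_right {γ : Type*} {R : Finset γ} {a : ℕ} {S : List γ}
    (hS : HasRounds R a S) (T : List γ) : HasRounds R a (S ++ T) :=
  hS.append (b := 0) trivial

theorem hasRounds_one {γ : Type*} {R : Finset γ} {S : List γ} (h : ∀ z ∈ R, z ∈ S) :
    HasRounds R 1 S :=
  ⟨[], S, rfl, trivial, h⟩

theorem HasRounds.mem {γ : Type*} {R : Finset γ} {k : ℕ} {S : List γ}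
    (h : HasRounds R (k + 1) S) : ∀ z ∈ R, z ∈ S := by
  obtain ⟨S', w, rfl, -, h2⟩ := h
  exact fun z hz => List.mem_append_right _ (h2 z hz)

theorem HasRounds.of_succ {γ : Type*} {R : Finset γ} {k : ℕ} {S : List γ}
    (h : HasRounds R (k + 1) S) : HasRounds R k S := by
  obtain ⟨S', w, rfl, h1, -⟩ := h
  exact h1.append_right w

theorem HasRounds.subset {γ : Type*} {R R' : Finset γ} (hR : R' ⊆ R) {k : ℕ} {S : List γ}
    (h : HasRounds R k S) : HasRounds R' k S := by
  induction k generalizing S with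
  | zero => trivial
  | succ k ih =>
    obtain ⟨S', w, rfl, h1, h2⟩ := h
    exact ⟨S', w, rfl, ih h1, fun z hz => h2 z (hR hz)⟩

/-- `S` has no `(r, s)`-formation. -/
def FormationFree {γ : Type*} (r s : ℕ) (S : List γ) : Prop :=
  ∀ R : Finset γ, R.card = r → ¬ HasRounds R s S

/-- If a list contains `R`, some element of `R` comes first after all the others. -/
theorem exists_last_new {γ : Type*} {R : Finset γ} (hR : R.Nonempty) {w : List γ}
    (h : ∀ z ∈ R, z ∈ w) :
    ∃ w₁ z w₂, w = w₁ ++ z :: w₂ ∧ z ∈ R ∧ ∀ x ∈ R, x ≠ z → x ∈ w₁ := by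
  induction w using List.reverseRecOn with
  | nil =>
    obtain ⟨z, hz⟩ := hR
    simpa using h z hz
  | append_singleton w a ih =>
    by_cases hw : ∀ z ∈ R, z ∈ w
    · obtain ⟨w₁, z, w₂, rfl, h1, h2⟩ := ih hw
      exact ⟨w₁, z, w₂ ++ [a], by simp, h1, h2⟩
    · push Not at hw
      obtain ⟨z, hz, hzw⟩ := hw
      have hza : z = a := by
        have := h z hz
        simp only [List.mem_append, List.mem_singleton] at this
        tauto
      subst hza
      refine ⟨w, z, [], rfl, hz, fun x hx hne => ?_⟩
      have := h x hx
      simp only [List.mem_append, List.mem_singleton] at this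
      tauto

/-- Every `(r, s - r + 1)`-formation contains every sequence of length `s` on `r` symbols. -/
theorem HasRounds.exists_map_sublist {β : Type*} [DecidableEq β] (u : List β) (R : Finset ℕ)
    (S : List ℕ) (hR : R.card = u.toFinset.card)
    (h : HasRounds R (u.length - u.toFinset.card + 1) S) :
    ∃ f : β → ℕ, Set.InjOn f {x | x ∈ u} ∧ (∀ x ∈ u, f x ∈ R) ∧ (u.map f).Sublist S := by
  induction u using List.reverseRecOn generalizing R S with
  | nil => exact ⟨fun _ => 0, by simp, by simp, by simp⟩
  | append_singleton u y ih =>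
    have hle := u.toFinset_card_le
    -- A repeated last symbol of `u` consumes one whole segment.
    by_cases hy : y ∈ u
    · have hset : (u ++ [y]).toFinset = u.toFinset := by
        ext x; simp only [List.mem_toFinset, List.mem_append, List.mem_singleton]
        constructor
        · rintro (h | rfl) <;> assumption
        · exact Or.inl
      rw [hset] at hR h
      rw [List.length_append, List.length_singleton, Nat.sub_add_comm hle] at h
      obtain ⟨S', w, rfl, h1, h2⟩ := h
      obtain ⟨f, hf, hfR, hsub⟩ := ih R S' hR h1
      refine ⟨f, ?_, ?_, ?_⟩
      · refine hf.mono fun x hx => ?_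
        have : x ∈ (u ++ [y]).toFinset := List.mem_toFinset.2 hx
        rw [hset] at this
        exact List.mem_toFinset.1 this
      · intro x hx
        have : x ∈ (u ++ [y]).toFinset := List.mem_toFinset.2 hx
        rw [hset] at this
        exact hfR x (List.mem_toFinset.1 this)
      · rw [List.map_append]
        exact hsub.append (by simpa using h2 _ (hfR y hy))
    -- A new last symbol costs no segment: it is sent to the `z ∈ R` that appears last in the final
    -- segment, and the part of that segment before `z` still serves `R.erase z`.
    · have hset : (u ++ [y]).toFinset.card = u.toFinset.card + 1 := by
        have : (u ++ [y]).toFinset = insert y u.toFinset := by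
          ext x; simp
        rw [this, card_insert_of_notMem (by simpa using hy)]
      rw [hset] at hR h
      rw [List.length_append, List.length_singleton, Nat.add_sub_add_right] at h
      obtain ⟨S', w, rfl, h1, h2⟩ := h
      obtain ⟨w₁, z, w₂, rfl, hz, hw₁⟩ := exists_last_new (card_pos.1 (by omega)) h2
      have h3 : HasRounds (R.erase z) (u.length - u.toFinset.card + 1) (S' ++ w₁) :=
        ⟨S', w₁, rfl, h1.subset (erase_subset _ _),
          fun x hx => hw₁ x (mem_of_mem_erase hx) (ne_of_mem_erase hx)⟩
      obtain ⟨f, hf, hfR, hsub⟩ := ih (R.erase z) _ (by rw [card_erase_of_mem hz]; omega) h3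
      have hfu : ∀ x ∈ u, Function.update f y z x = f x := fun x hx =>
        Function.update_of_ne (by rintro rfl; exact hy hx) _ _
      refine ⟨Function.update f y z, ?_, ?_, ?_⟩
      · intro x hx x' hx' he
        simp only [Set.mem_ofPred_eq, List.mem_append, List.mem_singleton] at hx hx'
        rcases hx with hx | rfl <;> rcases hx' with hx' | rfl
        · rw [hfu x hx, hfu x' hx'] at he
          exact hf hx hx' he
        · rw [hfu x hx, Function.update_self] at he
          exact absurd he (ne_of_mem_erase (hfR x hx))
        · rw [hfu x' hx', Function.update_self] at he
          exact absurd he.symm (ne_of_mem_erase (hfR x' hx'))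
        · rfl
      · intro x hx
        simp only [List.mem_append, List.mem_singleton] at hx
        rcases hx with hx | rfl
        · rw [hfu x hx]; exact mem_of_mem_erase (hfR x hx)
        · rwa [Function.update_self]
      · rw [List.map_append, List.map_congr_left hfu, ← List.append_assoc]
        refine hsub.append ?_
        simp

/-! ### Greedy chunking and the length bound for formation-free sequences. -/

theorem exists_minimal_prefix {γ : Type*} (P : List γ → Prop) (hP : ¬ P []) (S : List γ)
    (hS : P S) : ∃ w a T, S = (w ++ [a]) ++ T ∧ P (w ++ [a]) ∧ ¬ P w := by
  induction S using List.reverseRecOn with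
  | nil => exact absurd hS hP
  | append_singleton S a ih =>
    by_cases h : P S
    · obtain ⟨w, b, T, rfl, h1, h2⟩ := ih h
      exact ⟨w, b, T ++ [a], by simp, h1, h2⟩
    · exact ⟨S, a, [], by simp, hS, h⟩

/-- Repeatedly splits off the shortest prefix with property `P`; deleting its last letter destroys
`P`, which is what lets induction bound the chunk. -/
theorem exists_chunks {γ : Type*} (P : List γ → Prop) (hP : ¬ P []) (S : List γ) :
    ∃ (L : List (List γ)) (c : List γ), S = (L ++ [c]).flatten ∧ ¬ P c ∧
      ∀ w ∈ L, P w ∧ ∃ w' a, w = w' ++ [a] ∧ ¬ P w' := by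
  by_cases hS : P S
  · obtain ⟨w, a, T, rfl, h1, h2⟩ := exists_minimal_prefix P hP S hS
    obtain ⟨L, c, rfl, h3, h4⟩ := exists_chunks P hP T
    refine ⟨(w ++ [a]) :: L, c, by simp, h3, ?_⟩
    intro v hv
    rcases List.mem_cons.1 hv with rfl | hv
    · exact ⟨h1, w, a, rfl, h2⟩
    · exact h4 v hv
  · exact ⟨[], S, by simp, hS, by simp⟩
termination_by S.length
decreasing_by subst_vars; simp; omega

theorem length_flatten_eq_sum {γ : Type*} (C : List (List γ)) :
    C.flatten.length = ∑ i ∈ range C.length, (C.getD i []).length := by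
  induction C with
  | nil => simp
  | cons w C ih =>
    rw [List.length_cons, sum_range_succ', List.flatten_cons, List.length_append, ih]
    simp [add_comm]

theorem IsSparse.of_append {γ : Type*} {r : ℕ} {A B C : List γ}
    (h : IsSparse r (A ++ B ++ C)) : IsSparse r B := by
  intro i j hi hj hij hjr he
  have := h (A.length + i) (A.length + j) (by simp; omega) (by simp; omega) (by omega) (by omega)
  apply this
  rw [List.getElem_append_left (by simp; omega), List.getElem_append_right (by omega),
    List.getElem_append_left (by simp; omega), List.getElem_append_right (by omega)]
  simpa using he

theorem IsSparse.nodup {γ : Type*} {r : ℕ} {S : List γ} (h : IsSparse r S) (hr : S.length ≤ r) :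
    S.Nodup :=
  List.pairwise_iff_getElem.2 fun i j hi hj hij => h i j hi hj hij (by omega)

/-- Such a sequence has fewer than `r` symbols, whereas `r`-sparseness makes any `r` consecutive
letters distinct; so no letter repeats. -/
theorem FormationFree.length_le_card {r : ℕ} {S : List ℕ} (hS : IsSparse r S)
    (hF : FormationFree r 1 S) : S.length ≤ S.toFinset.card := by
  have hlt : S.toFinset.card < r := by
    by_contra! hle
    obtain ⟨R, hR, hcard⟩ := exists_subset_card_eq hle
    exact hF R hcard (hasRounds_one fun z hz => List.mem_toFinset.1 (hR hz))
  have hlen : S.length ≤ r := by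
    by_contra! hlen
    have h1 : IsSparse r ([] ++ S.take r ++ S.drop r) := by simpa using hS
    have h2 := h1.of_append.nodup (by simp)
    have h3 := List.toFinset_card_of_nodup h2
    rw [List.length_take, min_eq_left hlen.le] at h3
    have h4 : (S.take r).toFinset ⊆ S.toFinset := fun x hx =>
      List.mem_toFinset.2 (List.mem_of_mem_take (List.mem_toFinset.1 hx))
    have := card_le_card h4
    omega
  rw [List.toFinset_card_of_nodup (hS.nodup hlen)]

theorem mem_flatten_drop_take {γ : Type*} {C : List (List γ)} {v : γ} {x a b : ℕ}
    (hv : v ∈ C.getD x []) (ha : a ≤ x) (hb : x < b) : v ∈ ((C.take b).drop a).flatten := by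
  have hx : x < C.length := by
    by_contra! h
    rw [List.getD_eq_default _ _ h] at hv
    simp at hv
  rw [List.getD_eq_getElem _ _ hx] at hv
  refine List.mem_flatten.2 ⟨C[x], ?_, hv⟩
  refine List.mem_iff_getElem.2 ⟨x - a, by simp; omega, ?_⟩
  simp only [List.getElem_drop, List.getElem_take]
  congr 1; omega

/-- The chunks in which a symbol occurs. -/
def occurrences (C : List (List ℕ)) (v : ℕ) : Finset ℕ :=
  (range C.length).filter fun i => v ∈ C.getD i []

theorem FormationFree.not_formation {r s : ℕ} {C : List (List ℕ)}
    (hF : FormationFree r s C.flatten) (V : Finset ℕ) :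
    ¬ Formation r s V (occurrences C) := by
  rintro ⟨R, -, hcard, c, hc, H⟩
  have hrounds : ∀ i ≤ s, HasRounds R i (C.take (c i)).flatten := by
    intro i
    induction i with
    | zero => exact fun _ => trivial
    | succ i ih =>
      intro hi
      refine ⟨(C.take (c i)).flatten, ((C.take (c (i + 1))).drop (c i)).flatten, ?_,
        ih (by omega), fun v hv => ?_⟩
      · rw [← List.flatten_append]
        conv_lhs => rw [← List.take_append_drop (c i) (C.take (c (i + 1)))]
        rw [List.take_take, min_eq_left (hc (Nat.le_succ i))]
      · obtain ⟨x, hx, h1, h2⟩ := H i (by omega) v hv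
        exact mem_flatten_drop_take (mem_filter.1 hx).2 h1 h2
  have := (hrounds s le_rfl).append_right (C.drop (c s)).flatten
  rw [← List.flatten_append, List.take_append_drop] at this
  exact hF R hcard this

theorem mem_occurrences {C : List (List ℕ)} {v x : ℕ} :
    x ∈ occurrences C v ↔ v ∈ C.getD x [] := by
  refine ⟨fun h => (mem_filter.1 h).2, fun h => mem_filter.2 ⟨mem_range.2 ?_, h⟩⟩
  by_contra! hle
  rw [List.getD_eq_default _ _ hle] at h
  simp at h

/-- Chunks that contain an `(r, s)`-formation contain the first or last occurrence of a symbol. -/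
theorem FormationFree.card_chunks_le {r s : ℕ} (hs : 1 ≤ s) {L : List (List ℕ)} {c : List ℕ}
    (hF : FormationFree r (s + 2) (L ++ [c]).flatten)
    (hL : ∀ w ∈ L, ∃ R : Finset ℕ, R.card = r ∧ HasRounds R s w) :
    L.length ≤ 2 * (L ++ [c]).flatten.toFinset.card := by
  set C := L ++ [c] with hC
  set V := C.flatten.toFinset
  have hne : ∀ v ∈ V, (occurrences C v).Nonempty := by
    intro v hv
    obtain ⟨w, hw, hvw⟩ := List.mem_flatten.1 (List.mem_toFinset.1 hv)
    obtain ⟨i, hi, rfl⟩ := List.mem_iff_getElem.1 hw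
    exact ⟨i, mem_occurrences.2 (by rwa [List.getD_eq_getElem _ _ hi])⟩
  choose! lo hlo hlo' using fun v hv => exists_min_image (occurrences C v) id (hne v hv)
  choose! hi hhi hhi' using fun v hv => exists_max_image (occurrences C v) id (hne v hv)
  -- If chunk `i` were neither the first nor the last chunk of any symbol, its `(r, s)`-formation
  -- would gain one segment before and one after it.
  have hsub : range L.length ⊆ V.image lo ∪ V.image hi := by
    intro i hiL
    by_contra hnot
    simp only [mem_union, mem_image, not_or, not_exists, not_and] at hnot
    have hiL := mem_range.1 hiL
    have hiC : i < C.length := by simp [hC]; omega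
    have hCi : C[i] = L[i] := by simp [hC, List.getElem_append_left hiL]
    obtain ⟨R, hRcard, hR⟩ := hL L[i] (List.getElem_mem hiL)
    obtain ⟨s, rfl⟩ : ∃ k, s = k + 1 := ⟨s - 1, by omega⟩
    have hocc : ∀ v ∈ R, i ∈ occurrences C v := fun v hv => mem_occurrences.2 (by
      rw [List.getD_eq_getElem _ _ hiC, hCi]; exact hR.mem v hv)
    have hRV : ∀ v ∈ R, v ∈ V := fun v hv => List.mem_toFinset.2
      (List.mem_flatten.2 ⟨L[i], by rw [← hCi]; exact List.getElem_mem hiC, hR.mem v hv⟩)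
    have h1 : HasRounds R 1 (C.take i).flatten := hasRounds_one fun v hv => by
      have h2 : lo v ≤ i := hlo' v (hRV v hv) i (hocc v hv)
      have h3 := hnot.1 v (hRV v hv)
      have := mem_flatten_drop_take (mem_occurrences.1 (hlo v (hRV v hv))) (Nat.zero_le _)
        (lt_of_le_of_ne h2 h3)
      simpa using this
    have h2 : HasRounds R 1 (C.drop (i + 1)).flatten := hasRounds_one fun v hv => by
      have h2 : i ≤ hi v := hhi' v (hRV v hv) i (hocc v hv)
      have h3 := hnot.2 v (hRV v hv)
      have h4 : i + 1 ≤ hi v := by omega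
      have h5 := (mem_filter.1 (hhi v (hRV v hv))).1
      have := mem_flatten_drop_take (mem_occurrences.1 (hhi v (hRV v hv))) h4
        (mem_range.1 h5)
      simpa using this
    have h3 := (h1.append hR).append h2
    refine hF R hRcard ?_
    have e : C.flatten = (C.take i).flatten ++ L[i] ++ (C.drop (i + 1)).flatten := by
      conv_lhs => rw [← List.take_append_drop i C, List.drop_eq_getElem_cons hiC]
      rw [List.flatten_append, List.flatten_cons, hCi, List.append_assoc]
    rw [e]
    convert h3 using 1
    omega
  calc L.length = (range L.length).card := (card_range _).symm
    _ ≤ _ := card_le_card hsub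
    _ ≤ (V.image lo).card + (V.image hi).card := card_union_le _ _
    _ ≤ V.card + V.card := Nat.add_le_add card_image_le card_image_le
    _ = 2 * V.card := by ring

/-- Each chunk loses at most a factor `h + 1` when reduced to its distinct symbols, the `+ 1` paying
for its last letter; the rest is the count of (symbol, chunk) pairs. Since there are at most `2 * n
+ 1 ≤ 3 * n` chunks, `250` becomes `750`. -/
theorem FormationFree.length_le_step {r s d h : ℕ} (hr : 0 < r) (hs : 1 ≤ s) (hd : 1 ≤ d)
    (ih : ∀ S : List ℕ, IsSparse r S → FormationFree r s S → S.toFinset.card ≤ ackermann d →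
      S.length ≤ S.toFinset.card * h)
    (S : List ℕ) (hS : IsSparse r S) (hF : FormationFree r (s + 2) S)
    (hn : S.toFinset.card ≤ ackermann d) :
    S.length ≤ S.toFinset.card * ((h + 1) * ((occThreshold (s + 2) d + 1) * (750 * r + 1))) := by
  rcases S.eq_nil_or_concat' with rfl | ⟨T, a, hTa⟩
  · simp
  have hn0 : 0 < S.toFinset.card := card_pos.2 ⟨a, by simp [hTa]⟩
  clear hTa
  obtain ⟨L, c, hSC, hc, hL⟩ := exists_chunks
    (fun w => ∃ R : Finset ℕ, R.card = r ∧ HasRounds R s w) (by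
      rintro ⟨R, hR, h⟩
      obtain ⟨k, rfl⟩ : ∃ k, s = k + 1 := ⟨s - 1, by omega⟩
      obtain ⟨z, hz⟩ := card_pos.1 (hR ▸ hr)
      simpa using h.mem z hz) S
  set C := L ++ [c] with hC
  set V := S.toFinset with hV
  have hm : C.length ≤ 2 * V.card + 1 := by
    have := FormationFree.card_chunks_le (c := c) hs (by rw [← hC, ← hSC]; exact hF)
      fun w hw => (hL w hw).1
    rw [← hC, ← hSC, ← hV] at this
    simp only [hC, List.length_append, List.length_singleton]
    omega
  have hm0 : 0 < C.length := by simp [hC]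
  have hpart : ∀ A B D : List ℕ, S = A ++ B ++ D →
      (¬ ∃ R : Finset ℕ, R.card = r ∧ HasRounds R s B) → B.length ≤ B.toFinset.card * h := by
    rintro A B D rfl hB
    refine ih B hS.of_append (fun R hR hR' => hB ⟨R, hR, hR'⟩) (le_trans ?_ hn)
    refine card_le_card fun x hx => ?_
    simp only [hV, List.mem_toFinset, List.mem_append] at hx ⊢
    tauto
  have hchunk : ∀ w ∈ C, w.length ≤ w.toFinset.card * (h + 1) := by
    intro w hw
    obtain ⟨C₁, C₂, hC₁₂⟩ := List.append_of_mem hw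
    have hSw : S = C₁.flatten ++ w ++ C₂.flatten := by
      rw [hSC, hC₁₂]; simp
    rcases List.mem_append.1 hw with hwL | hwc
    · obtain ⟨-, w', b, rfl, hw'⟩ := hL w hwL
      have h1 := hpart C₁.flatten w' ([b] ++ C₂.flatten) (by rw [hSw]; simp) hw'
      have h2 : w'.toFinset.card ≤ (w' ++ [b]).toFinset.card :=
        card_le_card fun x hx =>
          List.mem_toFinset.2 (List.mem_append_left _ (List.mem_toFinset.1 hx))
      have h3 : 0 < (w' ++ [b]).toFinset.card := card_pos.2 ⟨b, by simp⟩
      have h4 := Nat.mul_le_mul_right h h2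
      rw [List.length_append, List.length_singleton, mul_add]
      omega
    · rw [List.mem_singleton.1 hwc] at hSw ⊢
      exact (hpart _ _ _ hSw hc).trans (Nat.mul_le_mul_left _ (Nat.le_succ h))
  have hfree : ¬ Formation r (s + 2) V (occurrences C) :=
    FormationFree.not_formation (by rw [← hSC]; exact hF) V
  have hB := two_mul_ackermann_le d hd
  have hsum := sum_card_le_of_not_formation (d := d) hr (by omega) hm0 (by omega) V
    (occurrences C) (fun v _ x hx => mem_range.1 (mem_filter.1 hx).1) hfree
  have hdouble : ∑ i ∈ range C.length, (C.getD i []).toFinset.card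
      = ∑ v ∈ V, (occurrences C v).card := by
    have h1 : ∀ i ∈ range C.length,
        (C.getD i []).toFinset.card = ∑ v ∈ V, if v ∈ C.getD i [] then 1 else 0 := by
      intro i hi
      rw [← card_filter]
      congr 1
      ext v
      have hi := mem_range.1 hi
      simp only [List.mem_toFinset, mem_filter, hV, List.getD_eq_getElem _ _ hi]
      refine ⟨fun hv => ⟨?_, hv⟩, fun hv => hv.2⟩
      rw [hSC]
      exact List.mem_flatten.2 ⟨_, List.getElem_mem hi, hv⟩
    rw [sum_congr rfl h1, sum_comm]
    refine sum_congr rfl fun v _ => ?_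
    rw [← card_filter]
    rfl
  calc S.length = ∑ i ∈ range C.length, (C.getD i []).length := by
        rw [hSC, length_flatten_eq_sum]
    _ ≤ ∑ i ∈ range C.length, (C.getD i []).toFinset.card * (h + 1) := by
        refine sum_le_sum fun i hi => ?_
        rw [List.getD_eq_getElem _ _ (mem_range.1 hi)]
        exact hchunk _ (List.getElem_mem _)
    _ = (∑ v ∈ V, (occurrences C v).card) * (h + 1) := by rw [← sum_mul, hdouble]
    _ ≤ ((occThreshold (s + 2) d + 1) * (250 * r * (3 * V.card) + V.card)) * (h + 1) := by
        refine Nat.mul_le_mul_right _ (hsum.trans ?_)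
        have : C.length ≤ 3 * V.card := by omega
        gcongr
    _ = _ := by ring

/-- Formation-free sequences are at most `lengthFactor` times as long as their number of
symbols. -/
def lengthFactor (r : ℕ) : ℕ → ℕ → ℕ
  | 0, _ => 1
  | 1, _ => 1
  | 2, _ => 2 * (3 * (750 * r + 1))
  | s + 3, d => (lengthFactor r (s + 1) d + 1) * ((occThreshold (s + 3) d + 1) * (750 * r + 1))

theorem FormationFree.length_le {r s d : ℕ} (hr : 0 < r) (hs : 1 ≤ s) (hd : 1 ≤ d)
    (S : List ℕ) (hS : IsSparse r S) (hF : FormationFree r s S)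
    (hn : S.toFinset.card ≤ ackermann d) :
    S.length ≤ S.toFinset.card * lengthFactor r s d := by
  induction s using Nat.strong_induction_on generalizing S with
  | _ s ih =>
  match s, hs with
  | 1, _ => simpa [lengthFactor] using hF.length_le_card hS
  | 2, _ =>
    -- Case `2` is weakened to `3`, so that the step of two starts from case `1`.
    have := FormationFree.length_le_step (h := 1) hr le_rfl hd
      (fun T hT hF' _ => by simpa using hF'.length_le_card hT) S hS
      (fun R hR h => hF R hR h.of_succ) hn
    simpa [lengthFactor, occThreshold] using this
  | s + 3, _ =>
    rw [lengthFactor]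
    exact FormationFree.length_le_step hr (by omega) hd
      (fun T hT hF' hn' => ih (s + 1) (by omega) (by omega) T hT hF' hn') S hS hF hn

/-! ### Asymptotics of the occurrence thresholds. -/

theorem occThreshold_four (d : ℕ) : occThreshold 4 d = 5 + 4 * d := by
  induction d with
  | zero => rw [occThreshold]
  | succ d ih =>
    rw [occThreshold_succ 0, ih, occThreshold, occThreshold]
    ring

theorem occThreshold_five (d : ℕ) : occThreshold 5 d + 8 * d + 26 = 31 * 2 ^ d := by
  induction d with
  | zero => rw [occThreshold]; norm_num
  | succ d ih =>
    rw [occThreshold_succ 1, occThreshold_four, show occThreshold (1 + 2) (d + 1) = 2 by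
      rw [occThreshold], pow_succ, ← mul_assoc, ← ih]
    ring

/-- Since `2 * T_{s+3} ≤ T_{s+4}`, the product term contributes at most half of the claimed bound,
leaving room for `2 * T_{s+4}`. -/
theorem occThreshold_le_five_mul_prod (s d : ℕ) :
    occThreshold (s + 5) d ≤ 5 * ∏ i ∈ range d, occThreshold (s + 4) (i + 1) := by
  induction d with
  | zero => simp [occThreshold]
  | succ d ih =>
    rw [occThreshold_succ (s + 1), prod_range_succ]
    set T := ∏ i ∈ range d, occThreshold (s + 4) (i + 1) with hT
    have hTpos : 0 < T := prod_pos fun i _ => occThreshold_pos _ _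
    have h2 : 2 * occThreshold (s + 3) (d + 1) ≤ occThreshold (s + 4) (d + 1) := by
      rw [occThreshold_succ s]; omega
    have h3 := Nat.mul_le_mul ih h2
    have h4 := Nat.le_mul_of_pos_left (occThreshold (s + 4) (d + 1)) hTpos
    have e1 : s + 1 + 2 = s + 3 := rfl
    have e2 : s + 1 + 3 = s + 4 := rfl
    have e3 : s + 1 + 4 = s + 5 := rfl
    rw [e1, e2, e3]
    nlinarith

/-- The product solves the homogeneous recurrence; by the preceding lemma each inhomogeneous term
adds at most `10` copies of it. -/
theorem occThreshold_le_mul_prod (s d : ℕ) :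
    occThreshold (s + 6) d ≤ (10 * d + 5) * ∏ i ∈ range d, occThreshold (s + 4) (i + 1) := by
  induction d with
  | zero => simp [occThreshold]
  | succ d ih =>
    have h1 := occThreshold_le_five_mul_prod s (d + 1)
    have h2 := Nat.mul_le_mul_right (occThreshold (s + 4) (d + 1)) ih
    rw [occThreshold_succ (s + 2)]
    have e1 : s + 2 + 2 = s + 4 := rfl
    have e2 : s + 2 + 3 = s + 5 := rfl
    have e3 : s + 2 + 4 = s + 6 := rfl
    rw [e1, e2, e3]
    rw [mul_assoc, ← prod_range_succ (fun i => occThreshold (s + 4) (i + 1))] at h2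
    linarith

/-- The binary logarithm of `occThreshold`. -/
noncomputable def logThreshold (s d : ℕ) : ℝ := Real.logb 2 (occThreshold s d)

theorem logThreshold_add_six_le (s d : ℕ) (hd : 1 ≤ d) :
    logThreshold (s + 6) d ≤ 4 * d + ∑ i ∈ range d, logThreshold (s + 4) (i + 1) := by
  have hpos : ∀ s d, (0 : ℝ) < occThreshold s d := fun s d => by exact_mod_cast occThreshold_pos s d
  have h16 : ∀ d : ℕ, 1 ≤ d → 10 * d + 5 ≤ 16 ^ d := by
    intro d hd
    induction d, hd using Nat.le_induction with
    | base => norm_num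
    | succ d _ ih => rw [pow_succ]; omega
  have h : (occThreshold (s + 6) d : ℝ) ≤
      16 ^ d * ∏ i ∈ range d, (occThreshold (s + 4) (i + 1) : ℝ) := by
    exact_mod_cast (occThreshold_le_mul_prod s d).trans (Nat.mul_le_mul_right _ (h16 d hd))
  have h2 := Real.logb_le_logb_of_le one_lt_two (hpos _ _) h
  rw [Real.logb_mul (by positivity) (prod_ne_zero_iff.2 fun i _ => (hpos _ _).ne'),
    Real.logb_prod _ _ (fun i _ => (hpos _ _).ne'), Real.logb_pow,
    show (16 : ℝ) = 2 ^ 4 by norm_num, Real.logb_pow, Real.logb_self_eq_one one_lt_two] at h2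
  unfold logThreshold
  push_cast at h2
  linarith

theorem pow_add_mul_pow_le (x : ℝ) (hx : 0 ≤ x) (t : ℕ) :
    x ^ (t + 1) + (t + 1) * x ^ t ≤ (x + 1) ^ (t + 1) := by
  induction t with
  | zero => simp
  | succ t ih =>
    have h1 := mul_le_mul_of_nonneg_left ih (by linarith : (0 : ℝ) ≤ x + 1)
    have h2 : (0 : ℝ) ≤ (t + 1) * x ^ t := by positivity
    push_cast
    calc x ^ (t + 1 + 1) + (t + 1 + 1) * x ^ (t + 1)
        ≤ (x + 1) * (x ^ (t + 1) + (t + 1) * x ^ t) := by ring_nf at h2 ⊢; linarith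
      _ ≤ _ := h1
      _ = _ := by ring

theorem sum_pow_le (t d : ℕ) :
    ∑ i ∈ range d, ((i + 1 : ℕ) : ℝ) ^ t ≤ (d : ℝ) ^ (t + 1) / (t + 1) + (d : ℝ) ^ t := by
  induction d with
  | zero => simp
  | succ d ih =>
    rw [sum_range_succ]
    have h := pow_add_mul_pow_le d (Nat.cast_nonneg d) t
    have h2 : (d : ℝ) ^ (t + 1) / (t + 1) + (d : ℝ) ^ t ≤ ((d : ℝ) + 1) ^ (t + 1) / (t + 1) := by
      rw [div_add' _ _ _ (by positivity)]
      gcongr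
      linarith
    push_cast at ih ⊢
    linarith

theorem sum_pow_le_pow_succ (t d : ℕ) :
    ∑ i ∈ range d, ((i + 1 : ℕ) : ℝ) ^ t ≤ (d : ℝ) ^ (t + 1) := by
  calc ∑ i ∈ range d, ((i + 1 : ℕ) : ℝ) ^ t ≤ ∑ _i ∈ range d, (d : ℝ) ^ t := by
        refine sum_le_sum fun i hi => ?_
        have : i + 1 ≤ d := mem_range.1 hi
        gcongr
    _ = _ := by rw [sum_const, card_range, nsmul_eq_mul]; ring

theorem inv_factorial_le_one (t : ℕ) : 1 / (t.factorial : ℝ) ≤ 1 := by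
  rw [div_le_one (by positivity)]
  exact_mod_cast Nat.one_le_iff_ne_zero.2 (Nat.factorial_ne_zero t)

theorem logb_natCast_le (d : ℕ) : Real.logb 2 d ≤ d := by
  rcases Nat.eq_zero_or_pos d with rfl | hd
  · simp
  · rw [Real.logb_le_iff_le_rpow one_lt_two (by exact_mod_cast hd), Real.rpow_natCast]
    exact_mod_cast Nat.lt_two_pow_self.le

/-- Summing `i ^ (t + 1) / (t + 1)!` gives the next leading term `d ^ (t + 2) / (t + 2)!`, and all
errors are `O(d ^ (t + 1))`. -/
theorem logThreshold_odd_le (t : ℕ) : ∃ C : ℝ, 0 ≤ C ∧ ∀ d : ℕ, 1 ≤ d →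
    logThreshold (2 * t + 5) d ≤
      1 / ((t + 1).factorial : ℝ) * (d : ℝ) ^ (t + 1) + C * (d : ℝ) ^ t := by
  induction t with
  | zero =>
    refine ⟨5, by norm_num, fun d hd => ?_⟩
    have h : (occThreshold 5 d : ℝ) ≤ 2 ^ 5 * 2 ^ d := by
      have := occThreshold_five d
      have h2 : occThreshold 5 d ≤ 2 ^ 5 * 2 ^ d := by omega
      exact_mod_cast h2
    have h2 := Real.logb_le_logb_of_le one_lt_two
      (by exact_mod_cast occThreshold_pos 5 d) h
    rw [← pow_add, Real.logb_pow, Real.logb_self_eq_one one_lt_two] at h2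
    push_cast at h2
    simp only [logThreshold]
    norm_num
    linarith
  | succ t ih =>
    obtain ⟨C, hC, h⟩ := ih
    refine ⟨4 + 1 + C, by positivity, fun d hd => ?_⟩
    have h1 := logThreshold_add_six_le (2 * t + 1) d hd
    have h2 : ∑ i ∈ range d, logThreshold (2 * t + 5) (i + 1) ≤
        1 / ((t + 1).factorial : ℝ) * ∑ i ∈ range d, ((i + 1 : ℕ) : ℝ) ^ (t + 1)
          + C * ∑ i ∈ range d, ((i + 1 : ℕ) : ℝ) ^ t := by
      rw [mul_sum, mul_sum, ← sum_add_distrib]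
      exact sum_le_sum fun i _ => h (i + 1) (by omega)
    have h3 := mul_le_mul_of_nonneg_left (sum_pow_le (t + 1) d)
      (by positivity : (0 : ℝ) ≤ 1 / ((t + 1).factorial : ℝ))
    have h4 := mul_le_mul_of_nonneg_left (sum_pow_le_pow_succ t d) hC
    have hd1 : (1 : ℝ) ≤ d := by exact_mod_cast hd
    have h5 : (d : ℝ) ≤ (d : ℝ) ^ (t + 1) := le_self_pow₀ hd1 (by omega)
    have h6 := mul_le_mul_of_nonneg_right (inv_factorial_le_one (t + 1))
      (by positivity : (0 : ℝ) ≤ (d : ℝ) ^ (t + 1))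
    have h7 : 1 / ((t + 1 + 1).factorial : ℝ) * (d : ℝ) ^ (t + 1 + 1) =
        1 / ((t + 1).factorial : ℝ) * ((d : ℝ) ^ (t + 1 + 1) / ((t + 1 : ℕ) + 1)) := by
      rw [Nat.factorial_succ (t + 1)]
      push_cast
      field_simp
    rw [show 2 * (t + 1) + 5 = 2 * t + 1 + 6 by ring, h7]
    rw [show 2 * t + 1 + 4 = 2 * t + 5 by ring] at h1
    rw [mul_add] at h3
    linarith

theorem logThreshold_even_le (t : ℕ) : ∃ C : ℝ, 0 ≤ C ∧ ∀ d : ℕ, 1 ≤ d →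
    logThreshold (2 * t + 4) d ≤
      1 / (t.factorial : ℝ) * (d : ℝ) ^ t * Real.logb 2 d + C * (d : ℝ) ^ t := by
  induction t with
  | zero =>
    refine ⟨4, by norm_num, fun d hd => ?_⟩
    have hd0 : (0 : ℝ) < d := by exact_mod_cast hd
    have h : (occThreshold 4 d : ℝ) ≤ 2 ^ 4 * d := by
      have := occThreshold_four d
      have h2 : occThreshold 4 d ≤ 2 ^ 4 * d := by omega
      exact_mod_cast h2
    have h2 := Real.logb_le_logb_of_le one_lt_two
      (by exact_mod_cast occThreshold_pos 4 d) h
    rw [Real.logb_mul (by norm_num) hd0.ne', Real.logb_pow,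
      Real.logb_self_eq_one one_lt_two] at h2
    push_cast at h2
    simp only [logThreshold]
    norm_num
    linarith
  | succ t ih =>
    obtain ⟨C, hC, h⟩ := ih
    refine ⟨4 + 1 + C, by positivity, fun d hd => ?_⟩
    have h1 := logThreshold_add_six_le (2 * t) d hd
    have hd1 : (1 : ℝ) ≤ d := by exact_mod_cast hd
    have hlog : 0 ≤ Real.logb 2 d := Real.logb_nonneg one_lt_two hd1
    have h2 : ∑ i ∈ range d, logThreshold (2 * t + 4) (i + 1) ≤
        1 / (t.factorial : ℝ) * Real.logb 2 d * ∑ i ∈ range d, ((i + 1 : ℕ) : ℝ) ^ t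
          + C * ∑ i ∈ range d, ((i + 1 : ℕ) : ℝ) ^ t := by
      rw [mul_sum, mul_sum, ← sum_add_distrib]
      -- Replacing `log (i + 1)` by `log d` leaves the leading term intact.
      refine sum_le_sum fun i hi => (h (i + 1) (by omega)).trans ?_
      have hid : ((i + 1 : ℕ) : ℝ) ≤ d := by exact_mod_cast mem_range.1 hi
      have := Real.logb_le_logb_of_le one_lt_two (by positivity) hid
      rw [mul_right_comm]
      gcongr
    have h3 := mul_le_mul_of_nonneg_left (sum_pow_le t d)
      (by positivity : (0 : ℝ) ≤ 1 / (t.factorial : ℝ) * Real.logb 2 d)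
    have h4 := mul_le_mul_of_nonneg_left (sum_pow_le_pow_succ t d) hC
    have h5 : (d : ℝ) ≤ (d : ℝ) ^ (t + 1) := le_self_pow₀ hd1 (by omega)
    have h6 : 1 / (t.factorial : ℝ) * Real.logb 2 d * (d : ℝ) ^ t ≤ (d : ℝ) ^ (t + 1) :=
      calc 1 / (t.factorial : ℝ) * Real.logb 2 d * (d : ℝ) ^ t ≤ 1 * d * (d : ℝ) ^ t := by
            gcongr
            · exact inv_factorial_le_one t
            · exact logb_natCast_le d
        _ = _ := by ring
    have h7 : 1 / ((t + 1).factorial : ℝ) * (d : ℝ) ^ (t + 1) * Real.logb 2 d =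
        1 / (t.factorial : ℝ) * Real.logb 2 d * ((d : ℝ) ^ (t + 1) / ((t : ℝ) + 1)) := by
      rw [Nat.factorial_succ t]
      push_cast
      field_simp
    rw [show 2 * (t + 1) + 4 = 2 * t + 6 by ring, h7]
    rw [mul_add] at h3
    linarith

/-! ### Asymptotics of the length factor. -/

theorem lengthFactor_pos (r s d : ℕ) : 0 < lengthFactor r s d := by
  fun_induction lengthFactor r s d <;> positivity

/-- The binary logarithm of `lengthFactor`. -/
noncomputable def logFactor (r s d : ℕ) : ℝ := Real.logb 2 (lengthFactor r s d)

theorem logFactor_add_three_le (r s d : ℕ) : logFactor r (s + 3) d ≤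
    logFactor r (s + 1) d + logThreshold (s + 3) d + (2 + Real.logb 2 (750 * r + 1)) := by
  have h1 := lengthFactor_pos r (s + 1) d
  have h2 := occThreshold_pos (s + 3) d
  have h : lengthFactor r (s + 3) d ≤
      (2 ^ 2 * (lengthFactor r (s + 1) d * occThreshold (s + 3) d)) * (750 * r + 1) := by
    rw [lengthFactor, ← mul_assoc]
    refine Nat.mul_le_mul_right _ ?_
    calc _ ≤ (2 * lengthFactor r (s + 1) d) * (2 * occThreshold (s + 3) d) :=
          Nat.mul_le_mul (by omega) (by omega)
      _ = _ := by ring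
  have h' : (lengthFactor r (s + 3) d : ℝ) ≤
      (2 ^ 2 * (lengthFactor r (s + 1) d * occThreshold (s + 3) d)) * (750 * r + 1) := by
    exact_mod_cast h
  have h1' : (0 : ℝ) < lengthFactor r (s + 1) d := by exact_mod_cast h1
  have h2' : (0 : ℝ) < occThreshold (s + 3) d := by exact_mod_cast h2
  have h3 := Real.logb_le_logb_of_le one_lt_two
    (by exact_mod_cast lengthFactor_pos r (s + 3) d) h'
  rw [Real.logb_mul (by positivity) (by positivity), Real.logb_mul (by positivity) (by positivity),
    Real.logb_mul (by positivity) (by positivity), Real.logb_pow,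
    Real.logb_self_eq_one one_lt_two] at h3
  unfold logFactor logThreshold
  push_cast at h3
  linarith

theorem logb_factor_nonneg (r : ℕ) : 0 ≤ Real.logb 2 (750 * (r : ℝ) + 1) :=
  Real.logb_nonneg one_lt_two (by linarith [(Nat.cast_nonneg r : (0 : ℝ) ≤ r)])

/-- A crude bound suffices here: in the final estimate this factor enters only through the error
term, the leading term coming from the top threshold alone. -/
theorem logFactor_odd_le_pow (r t : ℕ) : ∃ C : ℝ, 0 ≤ C ∧ ∀ d : ℕ, 1 ≤ d →
    logFactor r (2 * t + 3) d ≤ C * (d : ℝ) ^ t := by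
  induction t with
  | zero =>
    refine ⟨_, abs_nonneg (logFactor r 3 0), fun d _ => ?_⟩
    have : logFactor r 3 d = logFactor r 3 0 := by simp [logFactor, lengthFactor, occThreshold]
    simp only [mul_zero, zero_add, pow_zero, mul_one, this]
    exact le_abs_self _
  | succ t ih =>
    obtain ⟨C, hC, h⟩ := ih
    obtain ⟨C', hC', h'⟩ := logThreshold_odd_le t
    have hK := logb_factor_nonneg r
    refine ⟨C + (1 + C') + (2 + Real.logb 2 (750 * r + 1)), by positivity, fun d hd => ?_⟩
    have hd1 : (1 : ℝ) ≤ d := by exact_mod_cast hd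
    have h1 := logFactor_add_three_le r (2 * t + 2) d
    have h2 := h d hd
    have h3 := h' d hd
    have h4 : (d : ℝ) ^ t ≤ (d : ℝ) ^ (t + 1) := pow_le_pow_right₀ hd1 (by omega)
    have h5 : (1 : ℝ) ≤ (d : ℝ) ^ (t + 1) := one_le_pow₀ hd1
    have h6 := mul_le_mul_of_nonneg_right (inv_factorial_le_one (t + 1))
      (by positivity : (0 : ℝ) ≤ (d : ℝ) ^ (t + 1))
    have h7 := mul_le_mul_of_nonneg_left h4 hC
    have h8 := mul_le_mul_of_nonneg_left h4 hC'
    have h9 := mul_le_mul_of_nonneg_left h5 (by positivity : 0 ≤ 2 + Real.logb 2 (750 * (r : ℝ) + 1))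
    rw [show 2 * (t + 1) + 3 = 2 * t + 2 + 3 by ring]
    rw [show 2 * t + 2 + 1 = 2 * t + 3 by ring, show 2 * t + 2 + 3 = 2 * t + 5 by ring] at h1
    linarith

theorem logFactor_even_le_pow (r t : ℕ) : ∃ C : ℝ, 0 ≤ C ∧ ∀ d : ℕ, 1 ≤ d →
    logFactor r (2 * t + 2) d ≤ C * (d : ℝ) ^ t := by
  induction t with
  | zero =>
    refine ⟨_, abs_nonneg (logFactor r 2 0), fun d _ => ?_⟩
    have : logFactor r 2 d = logFactor r 2 0 := by simp [logFactor, lengthFactor]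
    simp only [mul_zero, zero_add, pow_zero, mul_one, this]
    exact le_abs_self _
  | succ t ih =>
    obtain ⟨C, hC, h⟩ := ih
    obtain ⟨C', hC', h'⟩ := logThreshold_even_le t
    have hK := logb_factor_nonneg r
    refine ⟨C + (1 + C') + (2 + Real.logb 2 (750 * r + 1)), by positivity, fun d hd => ?_⟩
    have hd1 : (1 : ℝ) ≤ d := by exact_mod_cast hd
    have h1 := logFactor_add_three_le r (2 * t + 1) d
    have h2 := h d hd
    have h3 := h' d hd
    have h4 : (d : ℝ) ^ t ≤ (d : ℝ) ^ (t + 1) := pow_le_pow_right₀ hd1 (by omega)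
    have h5 : (1 : ℝ) ≤ (d : ℝ) ^ (t + 1) := one_le_pow₀ hd1
    have h6 : 1 / (t.factorial : ℝ) * (d : ℝ) ^ t * Real.logb 2 d ≤ (d : ℝ) ^ (t + 1) :=
      calc 1 / (t.factorial : ℝ) * (d : ℝ) ^ t * Real.logb 2 d ≤ 1 * (d : ℝ) ^ t * d := by
            have := Real.logb_nonneg one_lt_two hd1
            gcongr
            · exact inv_factorial_le_one t
            · exact logb_natCast_le d
        _ = _ := by ring
    have h7 := mul_le_mul_of_nonneg_left h4 hC
    have h8 := mul_le_mul_of_nonneg_left h4 hC'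
    have h9 := mul_le_mul_of_nonneg_left h5 (by positivity : 0 ≤ 2 + Real.logb 2 (750 * (r : ℝ) + 1))
    rw [show 2 * (t + 1) + 2 = 2 * t + 1 + 3 by ring]
    rw [show 2 * t + 1 + 1 = 2 * t + 2 by ring, show 2 * t + 1 + 3 = 2 * t + 4 by ring] at h1
    linarith

theorem logFactor_odd_le (r t : ℕ) : ∃ C : ℝ, ∀ d : ℕ, 1 ≤ d →
    logFactor r (2 * t + 5) d ≤
      1 / ((t + 1).factorial : ℝ) * (d : ℝ) ^ (t + 1) + C * (d : ℝ) ^ t := by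
  obtain ⟨C, hC, h⟩ := logFactor_odd_le_pow r t
  obtain ⟨C', hC', h'⟩ := logThreshold_odd_le t
  have hK := logb_factor_nonneg r
  refine ⟨C + C' + (2 + Real.logb 2 (750 * r + 1)), fun d hd => ?_⟩
  have hd1 : (1 : ℝ) ≤ d := by exact_mod_cast hd
  have h1 := logFactor_add_three_le r (2 * t + 2) d
  have h2 := h d hd
  have h3 := h' d hd
  have h9 := mul_le_mul_of_nonneg_left (one_le_pow₀ hd1 : (1 : ℝ) ≤ (d : ℝ) ^ t)
    (by positivity : 0 ≤ 2 + Real.logb 2 (750 * (r : ℝ) + 1))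
  rw [show 2 * t + 2 + 1 = 2 * t + 3 by ring, show 2 * t + 2 + 3 = 2 * t + 5 by ring] at h1
  linarith

theorem logFactor_even_le (r t : ℕ) : ∃ C : ℝ, ∀ d : ℕ, 1 ≤ d →
    logFactor r (2 * t + 4) d ≤
      1 / (t.factorial : ℝ) * (d : ℝ) ^ t * Real.logb 2 d + C * (d : ℝ) ^ t := by
  obtain ⟨C, hC, h⟩ := logFactor_even_le_pow r t
  obtain ⟨C', hC', h'⟩ := logThreshold_even_le t
  have hK := logb_factor_nonneg r
  refine ⟨C + C' + (2 + Real.logb 2 (750 * r + 1)), fun d hd => ?_⟩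
  have hd1 : (1 : ℝ) ≤ d := by exact_mod_cast hd
  have h1 := logFactor_add_three_le r (2 * t + 1) d
  have h2 := h d hd
  have h3 := h' d hd
  have h9 := mul_le_mul_of_nonneg_left (one_le_pow₀ hd1 : (1 : ℝ) ≤ (d : ℝ) ^ t)
    (by positivity : 0 ≤ 2 + Real.logb 2 (750 * (r : ℝ) + 1))
  rw [show 2 * t + 1 + 1 = 2 * t + 2 by ring, show 2 * t + 1 + 3 = 2 * t + 4 by ring] at h1
  linarith

/-! ### The inverse Ackermann function and the extremal function. -/

theorem ackHierarchy_one_two (k : ℕ) :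
    ackHierarchy (k + 1) 1 = 2 ∧ ackHierarchy (k + 1) 2 = 4 := by
  induction k with
  | zero => exact ⟨rfl, rfl⟩
  | succ k ih =>
    have h1 : ackHierarchy (k + 2) 1 = 2 := by
      rw [ackHierarchy_succ, show ackHierarchy (k + 2) 0 = 1 from rfl, ih.1]
    exact ⟨h1, by rw [ackHierarchy_succ, h1, ih.2]⟩

theorem ackermann_lt_succ (k : ℕ) : ackermann (k + 1) < ackermann (k + 2) := by
  unfold ackermann
  rw [ackHierarchy_succ k 2, (ackHierarchy_one_two (k + 1)).2]
  cases k with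
  | zero => simp [ackHierarchy]
  | succ k =>
    rw [ackHierarchy_succ k 3]
    have := lt_ackHierarchy (k + 1) 3 (by omega)
    exact lt_ackHierarchy k _ (by omega)

theorem le_ackermann_succ (n : ℕ) : n ≤ ackermann (n + 1) := by
  induction n with
  | zero => exact Nat.zero_le _
  | succ n ih =>
    have : ackermann (n + 1) < ackermann (n + 1 + 1) := ackermann_lt_succ n
    omega

theorem invAckermann_spec (n : ℕ) :
    1 ≤ invAckermann n ∧ n ≤ ackermann (invAckermann n) := by
  have h : invAckermann (n : ℝ) ∈ {k : ℕ | 1 ≤ k ∧ (n : ℝ) ≤ (ackermann k : ℝ)} :=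
    Nat.sInf_mem ⟨n + 1, by omega, by exact_mod_cast le_ackermann_succ n⟩
  exact ⟨h.1, by exact_mod_cast h.2⟩

theorem numSymbols_eq_card {β : Type*} [DecidableEq β] (S : List β) :
    numSymbols S = S.toFinset.card := by
  rw [numSymbols, ← Set.ncard_coe_finset]
  congr 1
  ext x
  simp

theorem formationFree_of_not_contains {β : Type*} {u : List β} {S : List ℕ}
    (h : ¬ Contains S u) :
    FormationFree (numSymbols u) (u.length - numSymbols u + 1) S := by
  classical
  intro R hR hrounds
  rw [numSymbols_eq_card] at hR hrounds
  obtain ⟨f, hf, -, hsub⟩ := HasRounds.exists_map_sublist u R S hR hrounds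
  exact h ⟨f, hf, hsub⟩

theorem length_le_of_mem_freeLengths {β : Type*} {u : List β} (hu : 0 < numSymbols u) {n L : ℕ}
    (hL : L ∈ freeLengths u n) :
    L ≤ n * lengthFactor (numSymbols u) (u.length - numSymbols u + 1) (invAckermann n) := by
  obtain ⟨S, hS, hfree, rfl, rfl⟩ := hL
  obtain ⟨h1, h2⟩ := invAckermann_spec (numSymbols S)
  have := FormationFree.length_le hu (by omega) h1 S hS (formationFree_of_not_contains hfree)
    (by rwa [← numSymbols_eq_card])
  rwa [← numSymbols_eq_card] at this

/-- A sequence of distinct letters cannot contain `u`, which repeats a symbol; this makes the set of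
lengths nonempty, so the supremum is attained. -/
theorem mem_freeLengths_self {β : Type*} {u : List β} (hu : numSymbols u < u.length) (n : ℕ) :
    n ∈ freeLengths u n := by
  classical
  refine ⟨List.range n, ?_, ?_, ?_, List.length_range⟩
  · intro i j hi hj hij _
    simp only [List.getElem_range]
    omega
  · rintro ⟨f, -, hsub⟩
    have h := List.Nodup.of_map f (hsub.nodup List.nodup_range)
    rw [numSymbols_eq_card, List.toFinset_card_of_nodup h] at hu
    exact lt_irrefl _ hu
  · rw [numSymbols_eq_card, List.toFinset_range, card_range]

theorem isGreatest_Ex {β : Type*} {u : List β} (hu : 0 < numSymbols u)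
    (hu' : numSymbols u < u.length) (n : ℕ) : IsGreatest (freeLengths u n) (Ex u n) := by
  have hbdd : BddAbove (freeLengths u n) := ⟨_, fun L hL => length_le_of_mem_freeLengths hu hL⟩
  exact ⟨Nat.sSup_mem ⟨n, mem_freeLengths_self hu' n⟩ hbdd, fun L hL => le_csSup hbdd hL⟩

theorem Ex_le_mul_rpow {β : Type*} {u : List β} (hu : 0 < numSymbols u)
    (hu' : numSymbols u < u.length) (n : ℕ) {e : ℝ}
    (he : logFactor (numSymbols u) (u.length - numSymbols u + 1) (invAckermann n) ≤ e) :
    (Ex u n : ℝ) ≤ n * 2 ^ e := by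
  have h := length_le_of_mem_freeLengths hu (isGreatest_Ex hu hu' n).1
  have hpos := lengthFactor_pos (numSymbols u) (u.length - numSymbols u + 1) (invAckermann n)
  calc (Ex u n : ℝ) ≤ n * lengthFactor (numSymbols u) (u.length - numSymbols u + 1)
        (invAckermann n) := by exact_mod_cast h
    _ ≤ n * 2 ^ e := by
      refine mul_le_mul_of_nonneg_left ?_ (Nat.cast_nonneg n)
      exact (Real.logb_le_iff_le_rpow one_lt_two (by exact_mod_cast hpos)).1 he

end GenDS

theorem mainTheorem5 (r s t : ℕ) (hs : r + 3 ≤ s) (ht : t = (s - r - 2) / 2) :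
    ∃ C : ℝ, ∀ (β : Type*) (u : List β), GenDS.numSymbols u = r → u.length = s → ∀ n : ℕ,
      IsGreatest (GenDS.freeLengths u n) (GenDS.Ex u n) ∧
      (Even (s - r) →
        (GenDS.Ex u n : ℝ) ≤ (n : ℝ) * (2 : ℝ) ^
          ((1 / (Nat.factorial t : ℝ)) * (GenDS.invAckermann n : ℝ) ^ t
            + C * (GenDS.invAckermann n : ℝ) ^ (t - 1))) ∧
      (Odd (s - r) →
        (GenDS.Ex u n : ℝ) ≤ (n : ℝ) * (2 : ℝ) ^
          ((1 / (Nat.factorial t : ℝ)) * (GenDS.invAckermann n : ℝ) ^ t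
              * Real.logb 2 (GenDS.invAckermann n : ℝ)
            + C * (GenDS.invAckermann n : ℝ) ^ t)) := by
  have hpos : ∀ (β : Type _) (u : List β), u.length = s → 0 < GenDS.numSymbols u := by
    classical
    intro β u hlen
    obtain ⟨x, hx⟩ := List.exists_mem_of_length_pos (l := u) (by omega)
    rw [GenDS.numSymbols_eq_card]
    exact Finset.card_pos.2 ⟨x, List.mem_toFinset.2 hx⟩
  rcases Nat.even_or_odd (s - r) with hpar | hpar
  -- The formation length `s - r + 1` has parity opposite to `s - r`. Here `s - r ≥ 4`, so `t ≥ 1`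
  -- and `t - 1` is a true subtraction.
  · obtain ⟨C, hC⟩ := GenDS.logFactor_odd_le r (t - 1)
    refine ⟨C, fun β u hr hlen n => ⟨GenDS.isGreatest_Ex (hpos β u hlen) (by omega) n,
      fun _ => ?_, fun hodd => absurd hpar (Nat.not_even_iff_odd.2 hodd)⟩⟩
    obtain ⟨m, hm⟩ := hpar
    have h := hC _ (GenDS.invAckermann_spec n).1
    rw [show t - 1 + 1 = t by omega, show 2 * (t - 1) + 5 = s - r + 1 by omega] at h
    exact GenDS.Ex_le_mul_rpow (hpos β u hlen) (by omega) n (by rwa [hr, hlen])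
  · obtain ⟨C, hC⟩ := GenDS.logFactor_even_le r t
    refine ⟨C, fun β u hr hlen n => ⟨GenDS.isGreatest_Ex (hpos β u hlen) (by omega) n,
      fun heven => absurd heven (Nat.not_even_iff_odd.2 hpar), fun _ => ?_⟩⟩
    obtain ⟨m, hm⟩ := hpar
    have h := hC _ (GenDS.invAckermann_spec n).1
    rw [show 2 * t + 4 = s - r + 1 by omega] at h
    exact GenDS.Ex_le_mul_rpow (hpos β u hlen) (by omega) n (by rwa [hr, hlen])
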